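/- **Setting.** Let $\mathbb F$ be a field and $n\ge 0$. Let $(\mathcal A,\partial)$ be a differential graded algebra over $\mathbb F$ of the following kind. The algebra $\mathcal A=\mathbb F\langle a_1,\dots,a_m,t^{\pm1}\rangle$ is freely generated, with no commutation relations, by $a_1,\dots,a_m$ and an invertible letter $t$. It is $\mathbb Z$-graded with $|t|=0$. The map $\partial$ is $\mathbb F$-linear of degree $-1$, with $\partial^2=0$ and $\partial t=0$, and satisfies $\partial(uv)=\partial u\cdot v+(-1)^{|u|}u\,\partial v$. There are heights $h(a_i)\in\mathbb R$ such that $\partial a_i$ lies in the subalgebra generated by $t^{\pm1}$ and the $a_j$ with $h(a_j)<h(a_i)$. The example in mind is the fully noncommutative Chekanov–Eliashberg DGA, with coefficients in $\mathbb F$, of a Legendrian knot $\Lambda\subset\mathbb R^3$ of rotation number $0$ with one base point; there the $a_i$ are the Reeb chords. An $n$-dimensional representation is a unital DGA map $\rho:(\mathcal A,\partial)\to(\mathrm{Mat}_n(\mathbb F),0)$, where $\mathrm{Mat}_n(\mathbb F)$ sits in degree $0$. These are the objects of the (positive) representation category $\mathcal Rep_n(\Lambda,\mathbb F)$. The space $\mathrm{Hom}(\rho_1,\rho_2)$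 is the free $\mathrm{Mat}_n(\mathbb F)$-module on $a_1^\vee,\dots,a_m^\vee,x^\vee,y^\vee$, with $|a_i^\vee|=|a_i|+1$, $|x^\vee|=1$, $|y^\vee|=0$. The compositions come from the DGA of the $(k+1)$-copy. Its generators are $a_\ell^{ij}$ for all $i,j$, $x^{ij}$ and $y^{ij}$ for $i<j$, and $t_i^{\pm1}$. Put $A_\ell=(a_\ell^{ij})$, $X=1+(x^{ij})_{i<j}$, $Y=(y^{ij})_{i<j}$ and $\Delta=\mathrm{diag}(t_i)$. Then $$\partial A_\ell=\Phi(\partial a_\ell)+YA_\ell-(-1)^{|a_\ell|}A_\ell Y,\qquad \partial X=\Delta^{-1}Y\Delta X-XY,\qquad \partial Y=Y^2,$$ where $\Phi$ is the algebra map with $\Phi(a_\ell)=A_\ell$ and $\Phi(t)=\Delta X$. Given $\boldsymbol\rho=(\rho_1,\dots,\rho_{k+1})$, substitute $a_\ell^{ij}\mapsto a_\ell^{ij}+\delta_{ij}\rho_i(a_\ell)$ and $t_i\mapsto\rho_i(t)$ in the values of $\partial$ on generators to obtain $\partial^{\boldsymbol\rho}$. The $\mathbb F$-multilinear map $$m_k:\mathrm{Hom}(\rho_k,\rho_{k+1})\otimes\cdots\otimes\mathrm{Hom}(\rho_1,\rho_2)\to\mathrm{Hom}(\rho_1,\rho_{k+1})$$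 is determined as follows. Each term $A_kc_k^{12}A_{k-1}c_{k-1}^{23}\cdots c_1^{k,k+1}A_0$ of $\partial^{\boldsymbol\rho}(b^{1,k+1})$, with $A_j\in\mathrm{Mat}_n(\mathbb F)$, contributes $(-1)^{\sigma}(A_kM_kA_{k-1}\cdots M_1A_0)\,b^\vee$ to $m_k(M_1c_1^\vee,\dots,M_kc_k^\vee)$, where $\sigma=\frac{k(k-1)}2+\sum_{p<q}|c_p^\vee||c_q^\vee|+|c_2^\vee|+|c_4^\vee|+\cdots$. The strict unit of $\rho$ is $-y^\vee\in\mathrm{Hom}^0(\rho,\rho)$. Two representations $\rho,\rho_0$ are *isomorphic* if they are isomorphic in the cohomology category. That is, there are $\alpha\in\mathrm{Hom}^0(\rho,\rho_0)$ and $\beta\in\mathrm{Hom}^0(\rho_0,\rho)$ with $m_1\alpha=0$ and $m_1\beta=0$ such that $m_2(\beta,\alpha)$ and $m_2(\alpha,\beta)$ both equal $-y^\vee$ up to $m_1$ of an element of degree $-1$. Let $\mathrm{Hom}^0(\rho_1,\rho_2)^\times$ be the set of all $\alpha\in\mathrm{Hom}^0(\rho_1,\rho_2)$ with $m_1\alpha=0$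 which have a left and a right inverse under $m_2$, i.e. $m_2(\beta,\alpha)=-y^\vee$ and $m_2(\alpha,\beta')=-y^\vee$ for some $\beta,\beta'\in\mathrm{Hom}^0(\rho_2,\rho_1)$. **Proposition.** Suppose that $\rho$ and $\rho_0$ are isomorphic. Then there is a bijection from $\mathrm{Hom}^0(\rho,\rho_0)^\times$ to $\mathrm{Hom}^0(\rho,\rho)^\times$. More precisely, $\mathrm{Hom}^0(\rho_0,\rho)^\times$ is non-empty, and for every $g\in\mathrm{Hom}^0(\rho_0,\rho)^\times$ the map $\alpha\mapsto m_2(g,\alpha)$ restricts to a bijection $\mathrm{Hom}^0(\rho,\rho_0)^\times\to\mathrm{Hom}^0(\rho,\rho)^\times$. -/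

import Mathlib

namespace LegRep

/-! ### Free algebras with invertible letters -/

/-- The unital associative `F`-algebra freely generated by the letters in `S` and by the
invertible letters `t^{±1}`, `t ∈ T`: the monoid algebra of the free product of the free monoid
on `S` and the free group on `T`.  No letters commute with each other. -/
abbrev FreeAlg (F : Type*) [Field F] (S T : Type*) : Type _ :=
  MonoidAlgebra F (Monoid.Coprod (FreeMonoid S) (FreeGroup T))

namespace FreeAlg

variable {F : Type*} [Field F] {S T : Type*}

/-- The generator `s ∈ S`. -/
noncomputable def gen (s : S) : FreeAlg F S T :=
  MonoidAlgebra.of F (Monoid.Coprod (FreeMonoid S) (FreeGroup T))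
    (Monoid.Coprod.inl (FreeMonoid.of s))

/-- The invertible generator `t ∈ T`. -/
noncomputable def unit (t : T) : (FreeAlg F S T)ˣ :=
  Units.map ((MonoidAlgebra.of F (Monoid.Coprod (FreeMonoid S) (FreeGroup T))).comp
    Monoid.Coprod.inr) (toUnits (FreeGroup.of t))

/-- The algebra homomorphism with prescribed values on the generators. -/
noncomputable def lift {B : Type*} [Ring B] [Algebra F B] (f : S → B) (u : T → Bˣ) :
    FreeAlg F S T →ₐ[F] B :=
  MonoidAlgebra.lift F B (Monoid.Coprod (FreeMonoid S) (FreeGroup T))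
    (Monoid.Coprod.lift (FreeMonoid.lift f) ((Units.coeHom B).comp (FreeGroup.lift u)))

theorem lift_gen {B : Type*} [Ring B] [Algebra F B] (f : S → B) (u : T → Bˣ) (s : S) :
    lift (F := F) f u (gen s) = f s := by
  simp [lift, gen]

theorem lift_unit {B : Type*} [Ring B] [Algebra F B] (f : S → B) (u : T → Bˣ) (t : T) :
    lift (F := F) f u ((unit t : (FreeAlg F S T)ˣ) : FreeAlg F S T) = u t := by
  simp [lift, unit]

/-- The degree of a word, when `s ∈ S` has degree `deg s` and every `t ∈ T` has degree `0`. -/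
def wordDegree (deg : S → ℤ) :
    Monoid.Coprod (FreeMonoid S) (FreeGroup T) →* Multiplicative ℤ :=
  Monoid.Coprod.lift (FreeMonoid.lift fun s => Multiplicative.ofAdd (deg s)) 1

/-- The homogeneous elements of degree `p`: the span of the words of degree `p`. -/
noncomputable def homogeneous (deg : S → ℤ) (p : ℤ) : Submodule F (FreeAlg F S T) :=
  Submodule.span F {x | ∃ w : Monoid.Coprod (FreeMonoid S) (FreeGroup T),
    wordDegree deg w = Multiplicative.ofAdd p ∧ x = MonoidAlgebra.of F _ w}

end FreeAlg

/-! ### The differential graded algebra of a Legendrian knot -/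

/-- The algebra `F⟨a_1, …, a_m, t^{±1}⟩`, fully noncommutative (`t` does not commute with the
`a_i`). -/
abbrev KnotAlg (F : Type*) [Field F] (m : ℕ) : Type _ := FreeAlg F (Fin m) Unit

/-- The generator `a_i`. -/
noncomputable def chord {F : Type*} [Field F] {m : ℕ} (i : Fin m) : KnotAlg F m := FreeAlg.gen i

/-- The invertible generator `t` of the base point. -/
noncomputable def basept (F : Type*) [Field F] (m : ℕ) : (KnotAlg F m)ˣ := FreeAlg.unit ()

/-- A differential graded algebra over `F` of the type of the fully noncommutative
Chekanov--Eliashberg algebra of a Legendrian knot in `ℝ³` of rotation number `0` with one base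
point and with Reeb chords `a_1, …, a_m`: the algebra is free on the `a_i` and on `t^{±1}`, it is
`ℤ`-graded with `t` in degree `0`, and `∂` is a differential of degree `-1` which vanishes on
`F[t^{±1}]`, satisfies the signed Leibniz rule, and takes each `a_i` into the subalgebra generated
by `t^{±1}` and the chords of smaller height. -/
structure KnotDGA (F : Type*) [Field F] (m : ℕ) where
  /-- the degree `|a_i|` -/
  deg : Fin m → ℤ
  /-- the height `h(a_i)` -/
  height : Fin m → ℝ
  /-- the differential `∂` -/
  d : KnotAlg F m →ₗ[F] KnotAlg F m
  d_mem_homogeneous : ∀ (p : ℤ) (x : KnotAlg F m),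
    x ∈ FreeAlg.homogeneous deg p → d x ∈ FreeAlg.homogeneous deg (p - 1)
  leibniz : ∀ (p : ℤ) (x y : KnotAlg F m), x ∈ FreeAlg.homogeneous deg p →
    d (x * y) = d x * y + (Int.negOnePow p) • (x * d y)
  d_basept : d (basept F m : KnotAlg F m) = 0
  d_d : ∀ x : KnotAlg F m, d (d x) = 0
  d_chord_mem : ∀ i : Fin m, d (chord i) ∈ Algebra.adjoin F
    ({x : KnotAlg F m | ∃ j : Fin m, height j < height i ∧ x = chord j} ∪
      {x : KnotAlg F m | x = basept F m ∨ x = ((basept F m)⁻¹ : (KnotAlg F m)ˣ)})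

/-- `Mat_n(F)`. -/
abbrev Mat (n : ℕ) (F : Type*) : Type _ := Matrix (Fin n) (Fin n) F

/-- An `n`-dimensional representation: a unital DGA map `(𝒜, ∂) → (Mat_n(F), 0)`, where `Mat_n(F)`
sits in degree `0`. -/
structure Rep {F : Type*} [Field F] {m : ℕ} (D : KnotDGA F m) (n : ℕ) where
  /-- the underlying homomorphism of unital algebras -/
  toAlgHom : KnotAlg F m →ₐ[F] Mat n F
  map_d : ∀ x : KnotAlg F m, toAlgHom (D.d x) = 0
  map_of_degree_ne_zero : ∀ (p : ℤ) (x : KnotAlg F m), p ≠ 0 →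
    x ∈ FreeAlg.homogeneous D.deg p → toAlgHom x = 0

/-! ### The DGA of the `k`-copy -/

/-- The non-invertible generators of the DGA of the `k`-copy (components are numbered from `0`):
`a_ℓ^{ij}` for all `i, j`, and `x^{ij}`, `y^{ij}` for `i < j`. -/
inductive CopyGen (m k : ℕ) : Type
  | a (l : Fin m) (i j : Fin k) : CopyGen m k
  | x (i j : Fin k) (h : i < j) : CopyGen m k
  | y (i j : Fin k) (h : i < j) : CopyGen m k
  deriving DecidableEq

/-- The algebra of the `k`-copy; the invertible generators are `t_i`, one for each component. -/
abbrev CopyAlg (F : Type*) [Field F] (m k : ℕ) : Type _ := FreeAlg F (CopyGen m k) (Fin k)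

section CopyMatrices

variable (F : Type*) [Field F] (m k : ℕ)

/-- The matrix `A_ℓ = (a_ℓ^{ij})`. -/
noncomputable def copyA (l : Fin m) : Matrix (Fin k) (Fin k) (CopyAlg F m k) :=
  fun i j => FreeAlg.gen (CopyGen.a l i j)

/-- The strictly upper triangular matrix `(x^{ij})_{i<j}`. -/
noncomputable def copyXStrict : Matrix (Fin k) (Fin k) (CopyAlg F m k) :=
  fun i j => if h : i < j then FreeAlg.gen (CopyGen.x i j h) else 0

/-- The matrix `X`, upper triangular with `1` on the diagonal and entries `x^{ij}` above it. -/
noncomputable def copyX : Matrix (Fin k) (Fin k) (CopyAlg F m k) := 1 + copyXStrict F m k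

/-- The matrix `Y`, strictly upper triangular with entries `y^{ij}`. -/
noncomputable def copyY : Matrix (Fin k) (Fin k) (CopyAlg F m k) :=
  fun i j => if h : i < j then FreeAlg.gen (CopyGen.y i j h) else 0

theorem copyXStrict_pow_apply (p : ℕ) (i j : Fin k) (h : (j : ℕ) < (i : ℕ) + p) :
    (copyXStrict F m k ^ p) i j = 0 := by
  induction p generalizing j with
  | zero =>
    have hij : i ≠ j := by
      rintro rfl
      omega
    simp [hij]
  | succ p ih =>
    rw [pow_succ, Matrix.mul_apply]
    refine Finset.sum_eq_zero fun l _ => ?_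
    by_cases hl : (l : ℕ) < (i : ℕ) + p
    · rw [ih l hl, zero_mul]
    · have hlj : ¬ l < j := by
        rw [Fin.lt_def]
        omega
      simp [copyXStrict, hlj]

theorem isUnit_copyX : IsUnit (copyX F m k) := by
  refine IsNilpotent.isUnit_one_add ⟨k, ?_⟩
  refine Matrix.ext fun i j => ?_
  exact copyXStrict_pow_apply F m k k i j (by omega)

/-- The diagonal matrix `Δ` with entries `t_i`, as an invertible matrix. -/
noncomputable def copyDelta : (Matrix (Fin k) (Fin k) (CopyAlg F m k))ˣ where
  val := Matrix.diagonal fun i => ((FreeAlg.unit i : (CopyAlg F m k)ˣ) : CopyAlg F m k)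
  inv := Matrix.diagonal fun i => (((FreeAlg.unit i)⁻¹ : (CopyAlg F m k)ˣ) : CopyAlg F m k)
  val_inv := by simp
  inv_val := by simp

/-- The algebra homomorphism `Φ : 𝒜 → Mat_k(𝒜_k)` with `Φ(a_ℓ) = A_ℓ` and `Φ(t) = Δ X`, hence
`Φ(t⁻¹) = X⁻¹ Δ⁻¹`. -/
noncomputable def copyPhi : KnotAlg F m →ₐ[F] Matrix (Fin k) (Fin k) (CopyAlg F m k) :=
  FreeAlg.lift (copyA F m k) (fun _ => copyDelta F m k * (isUnit_copyX F m k).unit)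

end CopyMatrices

/-- The symbols labelling the generators of the morphism spaces: the Reeb chords `a_1, …, a_m` and
the two further symbols `x`, `y`. -/
inductive HomGen (m : ℕ) : Type
  | a (l : Fin m) : HomGen m
  | x : HomGen m
  | y : HomGen m
  deriving DecidableEq, Fintype

/-- The generator `c^{ij}` of the `k`-copy, `i < j`. -/
def HomGen.copy {m k : ℕ} (c : HomGen m) (i j : Fin k) (h : i < j) : CopyGen m k :=
  match c with
  | .a l => CopyGen.a l i j
  | .x => CopyGen.x i j h
  | .y => CopyGen.y i j h

section Category

variable {F : Type*} [Field F] {m : ℕ} (D : KnotDGA F m)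

/-- The differential of the `k`-copy on its generators, written as matrices: the `(i,j)` entry is
`∂(a_ℓ^{ij})`, `∂(x^{ij})`, `∂(y^{ij})` respectively.  (On the whole algebra `∂` is the extension
by `∂ t_i = 0` and the signed Leibniz rule; only its values on generators enter below.) -/
noncomputable def copyDiff (k : ℕ) (b : HomGen m) : Matrix (Fin k) (Fin k) (CopyAlg F m k) :=
  match b with
  | .a l => copyPhi F m k (D.d (chord l)) + copyY F m k * copyA F m k l
      - (Int.negOnePow (D.deg l)) • (copyA F m k l * copyY F m k)
  | .x => ((copyDelta F m k)⁻¹ : (Matrix (Fin k) (Fin k) (CopyAlg F m k))ˣ) * copyY F m k *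
      (copyDelta F m k : Matrix (Fin k) (Fin k) (CopyAlg F m k)) * copyX F m k
      - copyX F m k * copyY F m k
  | .y => copyY F m k * copyY F m k

end Category

/-! ### The tensor algebra of a free bimodule -/

/-- The relations which make `A` a unital subalgebra of the algebra generated by `A` and `S`. -/
inductive BimodRel (F : Type*) [Field F] (A : Type*) [Ring A] [Algebra F A] (S : Type*) :
    FreeAlgebra F (A ⊕ S) → FreeAlgebra F (A ⊕ S) → Prop
  | add (B C : A) : BimodRel F A S (FreeAlgebra.ι F (Sum.inl (B + C)))
      (FreeAlgebra.ι F (Sum.inl B) + FreeAlgebra.ι F (Sum.inl C))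
  | mul (B C : A) : BimodRel F A S (FreeAlgebra.ι F (Sum.inl (B * C)))
      (FreeAlgebra.ι F (Sum.inl B) * FreeAlgebra.ι F (Sum.inl C))
  | algebraMap (r : F) : BimodRel F A S (FreeAlgebra.ι F (Sum.inl (algebraMap F A r)))
      (algebraMap F (FreeAlgebra F (A ⊕ S)) r)

/-- The tensor algebra `T_A(M_A) = ⨁ M_A ⊗_A ⋯ ⊗_A M_A` of the free `A`-`A`-bimodule `M_A` on `S`,
presented as the algebra generated by the algebra `A` and the letters in `S` (so it is spanned by
the words `B_k s_k B_{k-1} ⋯ s_1 B_0` with `B_i ∈ A`, `s_i ∈ S`, and is the free product over `F`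
of `A` and the free algebra on `S`). -/
abbrev BimodTensorAlg (F : Type*) [Field F] (A : Type*) [Ring A] [Algebra F A] (S : Type*) :
    Type _ := RingQuot (BimodRel F A S)

namespace BimodTensorAlg

variable {F : Type*} [Field F] {A : Type*} [Ring A] [Algebra F A] {S : Type*}

/-- The letter `s ∈ S`. -/
noncomputable def gen (s : S) : BimodTensorAlg F A S :=
  RingQuot.mkAlgHom F (BimodRel F A S) (FreeAlgebra.ι F (Sum.inr s))

/-- The inclusion of the coefficient algebra. -/
noncomputable def coeffs : A →ₐ[F] BimodTensorAlg F A S where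
  toFun B := RingQuot.mkAlgHom F (BimodRel F A S) (FreeAlgebra.ι F (Sum.inl B))
  map_one' := by
    have h := RingQuot.mkAlgHom_rel F (BimodRel.algebraMap (F := F) (A := A) (S := S) 1)
    simpa using h
  map_mul' B C := by
    rw [RingQuot.mkAlgHom_rel F (BimodRel.mul B C), map_mul]
  map_zero' := by
    have h := RingQuot.mkAlgHom_rel F (BimodRel.algebraMap (F := F) (A := A) (S := S) 0)
    simpa using h
  map_add' B C := by
    rw [RingQuot.mkAlgHom_rel F (BimodRel.add B C), map_add]
  commutes' r := by
    rw [RingQuot.mkAlgHom_rel F (BimodRel.algebraMap r), AlgHom.commutes]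

/-- The algebra homomorphism given by an algebra homomorphism on `A` and values on the letters. -/
noncomputable def lift {B : Type*} [Ring B] [Algebra F B] (f : A →ₐ[F] B) (g : S → B) :
    BimodTensorAlg F A S →ₐ[F] B :=
  RingQuot.liftAlgHom F ⟨FreeAlgebra.lift F (Sum.elim f g), by
    intro p q h
    induction h <;> simp⟩

theorem lift_gen {B : Type*} [Ring B] [Algebra F B] (f : A →ₐ[F] B) (g : S → B) (s : S) :
    lift f g (gen s) = g s := by
  simp [lift, gen]

theorem lift_coeffs {B : Type*} [Ring B] [Algebra F B] (f : A →ₐ[F] B) (g : S → B) (C : A) :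
    lift f g (coeffs C) = f C := by
  simp [lift, coeffs]

/-- The homomorphism to `(k+1) × (k+1)` matrices over `A` which is `B ↦ diag(B, …, B)` on `A` and
takes a letter `s` to the matrix with entry `N p` in place `(p, p+1)` if `w p = s`, and `0`
elsewhere. -/
noncomputable def pathHom {k : ℕ} [DecidableEq S] (w : Fin k → S) (N : Fin k → A) :
    BimodTensorAlg F A S →ₐ[F] Matrix (Fin (k + 1)) (Fin (k + 1)) A :=
  lift (Matrix.scalarAlgHom (Fin (k + 1)) F)
    (fun s => ∑ p : Fin k,
      if w p = s then Matrix.single p.castSucc p.succ (N p) else 0)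

/-- The linear map `T_A(M_A) → A` which substitutes `N 0, …, N (k-1)` for the letters of the word
`w = w_0 ⋯ w_{k-1}` and kills all other words:
`B_0 s_0 B_1 s_1 ⋯ s_{k-1} B_k ↦ B_0 (N 0) B_1 (N 1) ⋯ (N (k-1)) B_k` if `s_i = w_i` for all `i`,
and every other word `B_0 s_0 ⋯ s_{l-1} B_l`, of whatever length, goes to `0`. -/
noncomputable def substWord {k : ℕ} [DecidableEq S] (w : Fin k → S) (N : Fin k → A)
    (z : BimodTensorAlg F A S) : A :=
  pathHom w N z 0 (Fin.last k)

end BimodTensorAlg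

/-! ### The representation category -/

section Category

variable {F : Type*} [Field F] {m : ℕ} {D : KnotDGA F m} {n : ℕ}

/-- The algebra homomorphism `φ_𝛒` from the algebra of the `k`-copy to the tensor algebra over
`Mat_n(F)` which twists by the pure representation `𝛒 = (ρ_1, …, ρ_k)`:
`a_ℓ^{ij} ↦ a_ℓ^{ij} + δ_{ij} ρ_i(a_ℓ)`, `x^{ij} ↦ x^{ij}`, `y^{ij} ↦ y^{ij}`, `t_i ↦ ρ_i(t)`. -/
noncomputable def twist {k : ℕ} (ρ : Fin k → Rep D n) :
    CopyAlg F m k →ₐ[F] BimodTensorAlg F (Mat n F) (CopyGen m k) :=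
  FreeAlg.lift
    (fun s => BimodTensorAlg.gen s +
      match s with
      | .a l i j => if i = j then BimodTensorAlg.coeffs ((ρ i).toAlgHom (chord l)) else 0
      | .x _ _ _ => 0
      | .y _ _ _ => 0)
    (fun i => Units.map
      (BimodTensorAlg.coeffs.comp (ρ i).toAlgHom :
        KnotAlg F m →ₐ[F] BimodTensorAlg F (Mat n F) (CopyGen m k)).toMonoidHom (basept F m))

/-- The augmented differential `∂^𝛒` of the `k`-copy on the generators, as a matrix: the `(i,j)`
entry is `∂^𝛒(b^{ij})`. -/
noncomputable def augDiff {k : ℕ} (ρ : Fin k → Rep D n) (b : HomGen m) :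
    Matrix (Fin k) (Fin k) (BimodTensorAlg F (Mat n F) (CopyGen m k)) :=
  (copyDiff D k b).map (twist ρ)

/-- `Hom(ρ₁, ρ₂)`, the free `Mat_n(F)`-module on `a_1^∨, …, a_m^∨, x^∨, y^∨`; the value of `α` at
`c` is the coefficient of `c^∨`. -/
abbrev Hom (_ρ₁ _ρ₂ : Rep D n) : Type _ := HomGen m → Mat n F

variable (D) in
/-- The degrees `|a_i^∨| = |a_i| + 1`, `|x^∨| = 1`, `|y^∨| = 0`. -/
def dualDeg : HomGen m → ℤ
  | .a l => D.deg l + 1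
  | .x => 1
  | .y => 0

/-- `Hom^p(ρ₁, ρ₂)`, the morphisms of degree `p`. -/
def HomDeg (p : ℤ) (ρ₁ ρ₂ : Rep D n) : Set (Hom ρ₁ ρ₂) :=
  {α | ∀ c : HomGen m, α c ≠ 0 → dualDeg D c = p}

variable (D) in
/-- The exponent `k(k-1)/2 + ∑_{p<q} |c_p^∨||c_q^∨| + |c_2^∨| + |c_4^∨| + ⋯` of the sign in `m_k`.
Positions in `Fin k` are numbered from `0`, so `c_2, c_4, …` are those with an odd number. -/
def signExp {k : ℕ} (c : Fin k → HomGen m) : ℤ :=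
  ((k * (k - 1) / 2 : ℕ) : ℤ)
    + (∑ p : Fin k, ∑ q : Fin k, if p < q then dualDeg D (c p) * dualDeg D (c q) else 0)
    + ∑ p : Fin k, if Odd (p : ℕ) then dualDeg D (c p) else 0

/-- The composition
`m_k : Hom(ρ_k, ρ_{k+1}) ⊗ ⋯ ⊗ Hom(ρ_1, ρ_2) → Hom(ρ_1, ρ_{k+1})`
(representations numbered from `0` in the code, and the `p`-th argument counted from the left).
A term `A_k c_k^{12} A_{k-1} c_{k-1}^{23} ⋯ c_1^{k,k+1} A_0` of `∂^𝛒(b^{1,k+1})` for the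
`(k+1)`-copy contributes `(-1)^σ (A_k M_k A_{k-1} ⋯ M_1 A_0) b^∨` to
`m_k(M_1 c_1^∨, …, M_k c_k^∨)`. -/
noncomputable def mk {k : ℕ} (ρ : Fin (k + 1) → Rep D n)
    (α : (p : Fin k) → Hom (ρ p.rev.castSucc) (ρ p.rev.succ)) : Hom (ρ 0) (ρ (Fin.last k)) :=
  fun b => ∑ c : Fin k → HomGen m, (Int.negOnePow (signExp D c)) •
    BimodTensorAlg.substWord
      (fun j : Fin k => (c j.rev).copy j.castSucc j.succ Fin.castSucc_lt_succ)
      (fun j : Fin k => α j.rev (c j.rev))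
      (augDiff ρ b 0 (Fin.last k))

/-- `m_1 : Hom(ρ₁, ρ₂) → Hom(ρ₁, ρ₂)`. -/
noncomputable def m₁ {ρ₁ ρ₂ : Rep D n} (α : Hom ρ₁ ρ₂) : Hom ρ₁ ρ₂ :=
  mk (k := 1) ![ρ₁, ρ₂] ![α]

/-- `m_2 : Hom(ρ₂, ρ₃) ⊗ Hom(ρ₁, ρ₂) → Hom(ρ₁, ρ₃)`. -/
noncomputable def m₂ {ρ₁ ρ₂ ρ₃ : Rep D n} (α : Hom ρ₂ ρ₃) (β : Hom ρ₁ ρ₂) : Hom ρ₁ ρ₃ :=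
  mk (k := 2) ![ρ₁, ρ₂, ρ₃] ![α, β]

/-- The strict unit `-y^∨ ∈ Hom(ρ, ρ)`. -/
def unitHom (ρ : Rep D n) : Hom ρ ρ
  | .y => -1
  | _ => 0

/-- `ρ₁` and `ρ₂` are isomorphic in the cohomology category `H^*Rep_n`: there are cocycles of
degree `0` in both directions whose compositions agree with the units `-y^∨` up to coboundaries. -/
def Isomorphic (ρ₁ ρ₂ : Rep D n) : Prop :=
  ∃ α ∈ HomDeg 0 ρ₁ ρ₂, ∃ β ∈ HomDeg 0 ρ₂ ρ₁, m₁ α = 0 ∧ m₁ β = 0 ∧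
    (∃ γ ∈ HomDeg (-1) ρ₁ ρ₁, m₂ β α = unitHom ρ₁ + m₁ γ) ∧
    (∃ γ ∈ HomDeg (-1) ρ₂ ρ₂, m₂ α β = unitHom ρ₂ + m₁ γ)

/-- `Hom^0(ρ₁, ρ₂)^×`: the cocycles in `Hom^0(ρ₁, ρ₂)` which have left and right inverses under
`m_2`. -/
def InvertibleCocycles (ρ₁ ρ₂ : Rep D n) : Set (Hom ρ₁ ρ₂) :=
  {α | α ∈ HomDeg 0 ρ₁ ρ₂ ∧ m₁ α = 0 ∧
    (∃ β ∈ HomDeg 0 ρ₂ ρ₁, m₂ β α = unitHom ρ₁) ∧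
    (∃ β ∈ HomDeg 0 ρ₂ ρ₁, m₂ α β = unitHom ρ₂)}

end Category

end LegRep

/-! The theorem reduces to one fact: a cocycle of degree 0 is invertible exactly when its
coefficient at `y^∨` is an invertible matrix (`mem_invertibleCocycles`).

In degree 0, `m₂` is minus the bilinear map `unsignedComp`, whose `y^∨` coefficient is the product
`α .y * β .y`. Composition with a fixed `g` is triangular for the order `y`, `x`, then chords by
height, because `∂ a_l` involves only lower chords. Up to sign, its diagonal blocks are
multiplications by `g .y`, conjugated by values of `t` in one `x` block. If `g .y` is a unit,
composition with `g` on either side is therefore injective, hence bijective on the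
finite-dimensional degree-0 part; one-sided inverses come from solving linear equations. The Leibniz
rule `m₁_unsignedComp` shows that composition with a cocycle `g` preserves cocycles, and injectivity
shows that it reflects them.

An isomorphism in cohomology supplies such a `g`: `m₁` never has a `y^∨` coefficient, so inverse up
to coboundary means genuinely inverse at `y^∨`.

The formulas for `m₁` and `m₂` come from evaluating the copy algebra in block matrices. There `Φ` of
a product expands as a sum over intermediate components, so the linear part of `Φ` is a derivation
and the quadratic part is a derivation up to a product of two linear parts. Such maps are determined
by their values on generators, and this uniqueness proves bilinearity and the identities behind the
Leibniz rule. -/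

namespace LegRep

/-! ### Twisted derivations on the free algebra. -/

section Derivations

variable {F : Type*} [Field F] {m : ℕ} {A : Type*} [Ring A] [Algebra F A]

/-- The words in the letters `a_i` and `t^{±1}`. -/
abbrev Word (m : ℕ) : Type := Monoid.Coprod (FreeMonoid (Fin m)) (FreeGroup Unit)

/-- A word as an element of the algebra. -/
noncomputable def word (F : Type*) [Field F] {m : ℕ} : Word m →* KnotAlg F m :=
  MonoidAlgebra.of F (Word m)

theorem word_chord (i : Fin m) : word F (Monoid.Coprod.inl (FreeMonoid.of i)) = chord i := rfl

theorem word_basept : word F (Monoid.Coprod.inr (FreeGroup.of ())) = (basept F m : KnotAlg F m) :=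
  rfl

theorem word_basept_inv : word F (Monoid.Coprod.inr (FreeGroup.of ())⁻¹) =
    (((basept F m)⁻¹ : (KnotAlg F m)ˣ) : KnotAlg F m) := by
  have h : (basept F m : KnotAlg F m) * word F (Monoid.Coprod.inr (FreeGroup.of ())⁻¹) = 1 := by
    rw [← word_basept, ← map_mul, ← map_mul]
    simp
  exact (Units.inv_eq_of_mul_eq_one_right h).symm

theorem Word.induction {p : Word m → Prop} (one : p 1) (mul : ∀ v w, p v → p w → p (v * w))
    (chord : ∀ i, p (Monoid.Coprod.inl (FreeMonoid.of i)))
    (basept : p (Monoid.Coprod.inr (FreeGroup.of ())))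
    (basept_inv : p (Monoid.Coprod.inr (FreeGroup.of ())⁻¹)) (w : Word m) : p w := by
  induction w using Monoid.Coprod.induction_on with
  | inl v =>
    induction v using FreeMonoid.inductionOn with
    | one => simpa using one
    | of i => exact chord i
    | mul v w hv hw => rw [map_mul]; exact mul _ _ hv hw
  | inr v =>
    induction v using FreeGroup.induction_on with
    | C1 => simpa using one
    | of i => exact basept
    | inv_of i _ => exact basept_inv
    | mul v w hv hw => rw [map_mul]; exact mul _ _ hv hw
  | mul v w hv hw => exact mul _ _ hv hw

theorem word_ext {f g : KnotAlg F m →ₗ[F] A} (h : ∀ w, f (word F w) = g (word F w)) : f = g :=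
  MonoidAlgebra.lhom_ext' fun w => LinearMap.ext_ring (h w)

theorem word_mem_homogeneous (deg : Fin m → ℤ) (w : Word m) :
    word F w ∈ FreeAlg.homogeneous (F := F) deg (FreeAlg.wordDegree deg w).toAdd :=
  Submodule.subset_span ⟨w, rfl, rfl⟩

/-- `f` is a derivation with respect to the bimodule structure given by `r₁` and `r₂`, twisted by
the bilinear correction term `B`. -/
def IsTwistedDerivation (r₁ r₂ : KnotAlg F m →ₐ[F] A) (B : Word m → Word m → A)
    (f : KnotAlg F m →ₗ[F] A) : Prop :=
  ∀ v w, f (word F (v * w)) =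
    r₁ (word F v) * f (word F w) + B v w + f (word F v) * r₂ (word F w)

variable {r₁ r₂ r₃ : KnotAlg F m →ₐ[F] A}

/-- All terms are bilinear in `u` and `v` once the correction is a product of linear maps, so the
identity passes from words to all elements, one variable at a time. -/
theorem IsTwistedDerivation.mul {f g h : KnotAlg F m →ₗ[F] A}
    (hf : IsTwistedDerivation r₁ r₂ (fun v w => g (word F v) * h (word F w)) f)
    (u v : KnotAlg F m) : f (u * v) = r₁ u * f v + g u * h v + f u * r₂ v := by
  have key : f ∘ₗ LinearMap.mulLeft F u =
      LinearMap.mulLeft F (r₁ u) ∘ₗ f + LinearMap.mulLeft F (g u) ∘ₗ h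
        + LinearMap.mulLeft F (f u) ∘ₗ r₂.toLinearMap := by
    refine word_ext fun w => ?_
    have key' : f ∘ₗ LinearMap.mulRight F (word F w) =
        LinearMap.mulRight F (f (word F w)) ∘ₗ r₁.toLinearMap
          + LinearMap.mulRight F (h (word F w)) ∘ₗ g
          + LinearMap.mulRight F (r₂ (word F w)) ∘ₗ f := by
      refine word_ext fun x => ?_
      simpa using hf x w
    simpa using LinearMap.congr_fun key' u
  simpa using LinearMap.congr_fun key v

theorem IsTwistedDerivation.mul_of_zero {f : KnotAlg F m →ₗ[F] A}
    (hf : IsTwistedDerivation r₁ r₂ 0 f)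
    (u v : KnotAlg F m) : f (u * v) = r₁ u * f v + f u * r₂ v := by
  have hf' : IsTwistedDerivation r₁ r₂ (fun v w => (0 : KnotAlg F m →ₗ[F] A) (word F v) *
      (0 : KnotAlg F m →ₗ[F] A) (word F w)) f := fun v w => by simpa using hf v w
  simpa using hf'.mul u v

theorem IsTwistedDerivation.map_one {f : KnotAlg F m →ₗ[F] A}
    (hf : IsTwistedDerivation r₁ r₂ 0 f) : f 1 = 0 := by
  have h := hf.mul_of_zero 1 1
  simpa using h

/-- Apply `f` to `t t⁻¹ = 1` and multiply on the left by `r₁ (t⁻¹)`. -/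
theorem IsTwistedDerivation.map_basept_inv {f : KnotAlg F m →ₗ[F] A}
    (hf : IsTwistedDerivation r₁ r₂ 0 f) : f ((basept F m)⁻¹ : (KnotAlg F m)ˣ) =
      - (r₁ ((basept F m)⁻¹ : (KnotAlg F m)ˣ) * f (basept F m) *
        r₂ ((basept F m)⁻¹ : (KnotAlg F m)ˣ)) := by
  have h := hf.mul_of_zero (basept F m) ((basept F m)⁻¹ : (KnotAlg F m)ˣ)
  rw [Units.mul_inv, hf.map_one] at h
  have h1 : r₁ ((basept F m)⁻¹ : (KnotAlg F m)ˣ) * r₁ (basept F m) = 1 := by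
    rw [← map_mul, Units.inv_mul, _root_.map_one]
  have h2 := congrArg (r₁ ((basept F m)⁻¹ : (KnotAlg F m)ˣ) * ·) h
  simp only [mul_zero, mul_add, ← mul_assoc, h1, one_mul] at h2
  exact eq_neg_of_add_eq_zero_left h2.symm

/-- A derivation is determined by its values on the generators. -/
theorem IsTwistedDerivation.ext {B : Word m → Word m → A} {f g : KnotAlg F m →ₗ[F] A}
    (hf : IsTwistedDerivation r₁ r₂ B f) (hg : IsTwistedDerivation r₁ r₂ B g)
    (chord : ∀ i, f (chord i) = g (chord i)) (basept : f (basept F m) = g (basept F m)) :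
    f = g := by
  -- The common correction term cancels in the difference, leaving an ordinary derivation that
  -- vanishes on the generators, hence also on `t⁻¹`.
  have h : IsTwistedDerivation r₁ r₂ 0 (f - g) := fun v w => by
    simp only [LinearMap.sub_apply, hf v w, hg v w, Pi.zero_apply]
    noncomm_ring
  have h0 : ∀ w, (f - g) (word F w) = 0 := fun w => by
    induction w using Word.induction with
    | one => simpa using h.map_one
    | mul v w hv hw => rw [h v w, hv, hw]; simp
    | chord i => rw [word_chord]; simp [chord]
    | basept => rw [word_basept]; simp [basept]
    | basept_inv => rw [word_basept_inv, h.map_basept_inv]; simp [basept]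
  exact word_ext fun w => sub_eq_zero.1 (h0 w)

end Derivations

/-! ### Block matrices supported along paths. -/

section PathMatrices

variable {A : Type*} [Ring A] {K : ℕ}

/-- Matrices of matrices whose only nonzero entries are the copies of `d i` in the diagonal block
`(i, i)` and, for `i < j`, the entry in the place `(i, j)` of the block `(i, j)`. -/
structure IsPathMatrix (d : Fin K → A)
    (M : Matrix (Fin K) (Fin K) (Matrix (Fin K) (Fin K) A)) : Prop where
  supp : ∀ i j p q, M i j p q ≠ 0 → i ≤ j ∧ (i = j → p = q) ∧ (i ≠ j → p = i ∧ q = j)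
  diag : ∀ i p, M i i p p = d i

theorem matrix_mul_apply_apply (M N : Matrix (Fin K) (Fin K) (Matrix (Fin K) (Fin K) A))
    (i j p q : Fin K) : (M * N) i j p q = ∑ l, ∑ r, M i l p r * N l j r q := by
  simp only [Matrix.mul_apply, Matrix.sum_apply]

namespace IsPathMatrix

variable {d d' : Fin K → A} {M N : Matrix (Fin K) (Fin K) (Matrix (Fin K) (Fin K) A)}

theorem apply_of_lt (hM : IsPathMatrix d M) {i j : Fin K} (h : j < i) (p q : Fin K) :
    M i j p q = 0 := by
  by_contra h0
  exact absurd (hM.supp _ _ _ _ h0).1 (not_le.2 h)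

/-- The entries along paths multiply like matrices. -/
theorem mul_apply (hM : IsPathMatrix d M) (i j : Fin K) :
    (M * N) i j i j = ∑ l, M i l i l * N l j l j := by
  rw [matrix_mul_apply_apply]
  refine Finset.sum_congr rfl fun l _ => ?_
  -- The inner index is forced to be `l`: a diagonal block is itself diagonal, and an off-diagonal
  -- block `(i, l)` lives only in column `l`.
  refine Finset.sum_eq_single l (fun r _ hr => ?_) (by simp)
  by_cases h : M i l i r = 0
  · rw [h, zero_mul]
  · have h1 := hM.supp _ _ _ _ h
    by_cases hil : i = l
    · exact absurd ((h1.2.1 hil).symm.trans hil) hr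
    · exact absurd (h1.2.2 hil).2 hr

theorem mul (hM : IsPathMatrix d M) (hN : IsPathMatrix d' N) :
    IsPathMatrix (d * d') (M * N) where
  supp i j p q h := by
    rw [matrix_mul_apply_apply] at h
    obtain ⟨l, _, hl⟩ := Finset.exists_ne_zero_of_sum_ne_zero h
    obtain ⟨r, _, hr⟩ := Finset.exists_ne_zero_of_sum_ne_zero hl
    have h1 := hM.supp _ _ _ _ (left_ne_zero_of_mul hr)
    have h2 := hN.supp _ _ _ _ (right_ne_zero_of_mul hr)
    grind
  diag i p := by
    rw [matrix_mul_apply_apply, Finset.sum_eq_single i, Finset.sum_eq_single p]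
    · rw [hM.diag, hN.diag, Pi.mul_apply]
    · intro r _ hr
      by_cases h : M i i p r = 0
      · rw [h, zero_mul]
      · exact absurd ((hM.supp _ _ _ _ h).2.1 rfl).symm hr
    · simp
    · intro l _ hl
      refine Finset.sum_eq_zero fun r _ => ?_
      rcases lt_or_gt_of_ne hl with h | h
      · rw [hM.apply_of_lt h, zero_mul]
      · rw [hN.apply_of_lt h, mul_zero]
    · simp

theorem add (hM : IsPathMatrix d M) (hN : IsPathMatrix d' N) :
    IsPathMatrix (d + d') (M + N) where
  supp i j p q h := by
    by_cases h0 : M i j p q = 0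
    · refine hN.supp _ _ _ _ fun h1 => h ?_
      simp [h0, h1]
    · exact hM.supp _ _ _ _ h0
  diag i p := by simp [hM.diag, hN.diag]

theorem diagonal (d : Fin K → A) :
    IsPathMatrix d (Matrix.diagonal fun i => Matrix.diagonal fun _ => d i) where
  supp i j p q h := by
    by_cases hij : i = j
    · subst hij
      by_cases hpq : p = q
      · exact ⟨le_rfl, fun _ => hpq, fun h => absurd rfl h⟩
      · simp [hpq] at h
    · simp [hij] at h
  diag i p := by simp

theorem one : IsPathMatrix (1 : Fin K → A) 1 := by
  have h := diagonal (1 : Fin K → A)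
  simpa using h

theorem neg (hM : IsPathMatrix d M) : IsPathMatrix (-d) (-M) where
  supp i j p q h := hM.supp i j p q (by simpa using h)
  diag i p := by simp [hM.diag]

theorem pow_succ (hM : IsPathMatrix 0 M) (p : ℕ) : IsPathMatrix 0 (M ^ (p + 1)) := by
  induction p with
  | zero => simpa using hM
  | succ p ih => simpa [_root_.pow_succ] using ih.mul hM

/-- The inverse is the finite geometric series in `-M`, and every term after the first is a path
matrix with zero diagonal. -/
theorem inverse_one_add (hM : IsPathMatrix 0 M) (hn : IsNilpotent M)
    (h : (1 + M) * N = 1) : IsPathMatrix 1 N := by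
  obtain ⟨e, he⟩ := hn
  -- Summing up to exponent `e` inclusive keeps the term `1` even when `e = 0`.
  have hs : ∀ e : ℕ, IsPathMatrix 1 (∑ p ∈ Finset.range (e + 1), (-M) ^ p) := by
    intro e
    induction e with
    | zero => simpa using one
    | succ e ih =>
      rw [Finset.sum_range_succ]
      have hneg : IsPathMatrix 0 (-M) := by simpa using hM.neg
      simpa using ih.add (hneg.pow_succ e)
  have hN : N = ∑ p ∈ Finset.range (e + 1), (-M) ^ p := by
    have h1 : (∑ p ∈ Finset.range (e + 1), (-M) ^ p) * (1 + M) = 1 := by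
      have h2 := geom_sum_mul_neg (-M) (e + 1)
      rw [sub_neg_eq_add] at h2
      rw [h2, neg_pow, _root_.pow_succ M, he]
      simp
    calc N = ((∑ p ∈ Finset.range (e + 1), (-M) ^ p) * (1 + M)) * N := by rw [h1, one_mul]
      _ = _ := by rw [mul_assoc, h, mul_one]
  rw [hN]
  exact hs e

end IsPathMatrix

end PathMatrices

/-! ### Evaluation of the copy algebra along a path of generators. -/

section PathEvaluation

variable {F : Type*} [Field F] {m : ℕ} {D : KnotDGA F m} {n k : ℕ}

open BimodTensorAlg

/-- The value of the generator `s` under the evaluation along the path `c_k^{12}, …, c_1^{k,k+1}`. -/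
noncomputable def pathGen (c : Fin k → HomGen m) (N : Fin k → Mat n F) (s : CopyGen m (k + 1)) :
    Matrix (Fin (k + 1)) (Fin (k + 1)) (Mat n F) :=
  pathHom (F := F) (fun j : Fin k => (c j.rev).copy j.castSucc j.succ Fin.castSucc_lt_succ) N (gen s)

/-- The evaluation of the `(k+1)`-copy along the path of generators `c_k^{12}, …, c_1^{k,k+1}`. -/
noncomputable def pathEval (ρ : Fin (k + 1) → Rep D n) (c : Fin k → HomGen m)
    (N : Fin k → Mat n F) :
    CopyAlg F m (k + 1) →ₐ[F] Matrix (Fin (k + 1)) (Fin (k + 1)) (Mat n F) :=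
  (pathHom (fun j : Fin k => (c j.rev).copy j.castSucc j.succ Fin.castSucc_lt_succ) N).comp
    (twist ρ)

/-- The evaluation of matrices over the `(k+1)`-copy. -/
noncomputable def pathEvalMatrix (ρ : Fin (k + 1) → Rep D n) (c : Fin k → HomGen m)
    (N : Fin k → Mat n F) : Matrix (Fin (k + 1)) (Fin (k + 1)) (CopyAlg F m (k + 1)) →ₐ[F]
      Matrix (Fin (k + 1)) (Fin (k + 1)) (Matrix (Fin (k + 1)) (Fin (k + 1)) (Mat n F)) :=
  (pathEval ρ c N).mapMatrix

variable (ρ : Fin (k + 1) → Rep D n) (c : Fin k → HomGen m) (N : Fin k → Mat n F)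

theorem pathGen_apply (s : CopyGen m (k + 1)) (p q : Fin (k + 1)) :
    pathGen c N s p q =
    ∑ r : Fin k, if (c r.rev).copy r.castSucc r.succ Fin.castSucc_lt_succ = s ∧
      r.castSucc = p ∧ r.succ = q then N r else 0 := by
  rw [pathGen, pathHom, lift_gen, Matrix.sum_apply]
  refine Finset.sum_congr rfl fun r _ => ?_
  by_cases h : (c r.rev).copy r.castSucc r.succ Fin.castSucc_lt_succ = s
  · simp only [h, if_true, true_and, Matrix.single_apply]
  · simp [h]

theorem pathGen_apply_ne_zero {s : CopyGen m (k + 1)} {p q : Fin (k + 1)}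
    (h : pathGen c N s p q ≠ 0) :
    ∃ r : Fin k, (c r.rev).copy r.castSucc r.succ Fin.castSucc_lt_succ = s ∧
      r.castSucc = p ∧ r.succ = q := by
  rw [pathGen_apply] at h
  obtain ⟨r, _, hr⟩ := Finset.exists_ne_zero_of_sum_ne_zero h
  exact ⟨r, by by_contra h0; exact hr (if_neg h0)⟩

theorem HomGen.copy_inj {c c' : HomGen m} {K : ℕ} {i j : Fin K} {h h' : i < j} :
    c.copy i j h = c'.copy i j h' ↔ c = c' := by
  cases c <;> cases c' <;> simp [HomGen.copy]

theorem HomGen.copy_inj_left {c c' : HomGen m} {K : ℕ} {i j i' j' : Fin K} {h : i < j}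
    {h' : i' < j'} (e : c.copy i j h = c'.copy i' j' h') : i = i' ∧ j = j' := by
  cases c <;> cases c' <;> simp_all [HomGen.copy]

/-- The value at consecutive places of the generators `c^{ij}`. -/
theorem pathGen_copy_apply (c' : HomGen m) (r : Fin k) :
    pathGen c N (c'.copy r.castSucc r.succ Fin.castSucc_lt_succ) r.castSucc r.succ =
    if c r.rev = c' then N r else 0 := by
  rw [pathGen_apply, Finset.sum_eq_single r]
  · simp [HomGen.copy_inj]
  · intro q _ hq
    rw [if_neg]
    rintro ⟨-, h, -⟩
    exact hq (Fin.castSucc_injective _ h)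
  · simp

theorem pathGen_copy_ne_zero {c' : HomGen m} {i j : Fin (k + 1)} {h : i < j} {p q : Fin (k + 1)}
    (h0 : pathGen c N (c'.copy i j h) p q ≠ 0) : p = i ∧ q = j ∧ (j : ℕ) = i + 1 := by
  obtain ⟨r, h1, rfl, rfl⟩ := pathGen_apply_ne_zero _ _ h0
  obtain ⟨rfl, rfl⟩ := HomGen.copy_inj_left h1
  simp

theorem pathEvalMatrix_copyY_apply (i j : Fin (k + 1)) :
    pathEvalMatrix ρ c N (copyY F m (k + 1)) i j = if h : i < j then
      pathGen c N (HomGen.y.copy i j h) else 0 := by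
  by_cases h : i < j
  · simp [pathEvalMatrix, copyY, h, pathEval, twist, FreeAlg.lift_gen, HomGen.copy, pathGen]
  · simp [pathEvalMatrix, copyY, h]

theorem pathEvalMatrix_copyXStrict_apply (i j : Fin (k + 1)) :
    pathEvalMatrix ρ c N (copyXStrict F m (k + 1)) i j = if h : i < j then
      pathGen c N (HomGen.x.copy i j h) else 0 := by
  by_cases h : i < j
  · simp [pathEvalMatrix, copyXStrict, h, pathEval, twist, FreeAlg.lift_gen, HomGen.copy, pathGen]
  · simp [pathEvalMatrix, copyXStrict, h]

theorem pathEvalMatrix_copyA_apply (l : Fin m) (i j : Fin (k + 1)) :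
    pathEvalMatrix ρ c N (copyA F m (k + 1) l) i j = (if h : i < j then
      pathGen c N ((HomGen.a l).copy i j h) else 0) +
      Matrix.diagonal (fun i => Matrix.diagonal
        fun _ : Fin (k + 1) => (ρ i).toAlgHom (chord l)) i j := by
  have h1 : pathEvalMatrix ρ c N (copyA F m (k + 1) l) i j =
      pathGen c N (CopyGen.a l i j) +
      Matrix.diagonal (fun i => Matrix.diagonal
        fun _ : Fin (k + 1) => (ρ i).toAlgHom (chord l)) i j := by
    simp only [pathEvalMatrix, copyA, pathEval, twist, AlgHom.mapMatrix_apply, Matrix.map_apply,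
      AlgHom.comp_apply, FreeAlg.lift_gen, map_add, pathGen]
    congr 1
    by_cases h : i = j
    · subst h
      simp [pathHom, lift_coeffs, Matrix.scalar]
    · simp [h]
  rw [h1]
  congr 1
  by_cases h : i < j
  · simp [h, HomGen.copy]
  -- Generators `a^{ij}` with `i ≥ j` exist, but every letter of the path goes from one component to
  -- the next, so they evaluate to zero apart from the twist.
  · rw [dif_neg h]
    ext1 p q
    by_contra h0
    obtain ⟨r, h1, -, -⟩ := pathGen_apply_ne_zero _ _ h0
    generalize c r.rev = c' at h1
    cases c' <;> simp only [HomGen.copy, reduceCtorEq, CopyGen.a.injEq] at h1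
    obtain ⟨-, rfl, rfl⟩ := h1
    exact h Fin.castSucc_lt_succ

theorem isPathMatrix_copy (c' : HomGen m) : IsPathMatrix (0 : Fin (k + 1) → Mat n F)
    (fun i j => if h : i < j then
      pathGen c N (c'.copy i j h) else 0) where
  supp i j p q h0 := by
    by_cases h : i < j
    · simp only [h, dif_pos] at h0
      obtain ⟨rfl, rfl, -⟩ := pathGen_copy_ne_zero _ _ h0
      exact ⟨h.le, fun e => e, fun _ => ⟨rfl, rfl⟩⟩
    · simp [h] at h0
  diag i p := by simp

theorem isPathMatrix_copyY :
    IsPathMatrix 0 (pathEvalMatrix ρ c N (copyY F m (k + 1))) := by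
  have h := isPathMatrix_copy c N HomGen.y
  rwa [show pathEvalMatrix ρ c N (copyY F m (k + 1)) = _ from
    Matrix.ext fun i j => pathEvalMatrix_copyY_apply ρ c N i j]

theorem isPathMatrix_copyXStrict :
    IsPathMatrix 0 (pathEvalMatrix ρ c N (copyXStrict F m (k + 1))) := by
  have h := isPathMatrix_copy c N HomGen.x
  rwa [show pathEvalMatrix ρ c N (copyXStrict F m (k + 1)) = _ from
    Matrix.ext fun i j => pathEvalMatrix_copyXStrict_apply ρ c N i j]

theorem isPathMatrix_copyA (l : Fin m) :
    IsPathMatrix (fun i => (ρ i).toAlgHom (chord l))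
      (pathEvalMatrix ρ c N (copyA F m (k + 1) l)) := by
  have h := (isPathMatrix_copy c N (HomGen.a l)).add
    (IsPathMatrix.diagonal fun i => (ρ i).toAlgHom (chord l))
  rw [zero_add] at h
  rwa [show pathEvalMatrix ρ c N (copyA F m (k + 1) l) = _ from
    Matrix.ext fun i j => pathEvalMatrix_copyA_apply ρ c N l i j]

theorem pathEvalMatrix_copyDelta :
    pathEvalMatrix ρ c N (copyDelta F m (k + 1) : Matrix _ _ _) =
      Matrix.diagonal fun i => Matrix.diagonal
        fun _ : Fin (k + 1) => (ρ i).toAlgHom (basept F m) := by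
  rw [pathEvalMatrix, copyDelta, AlgHom.mapMatrix_apply, Matrix.diagonal_map (map_zero _)]
  congr 1
  funext i
  simp [pathEval, twist, FreeAlg.lift_unit, pathHom, lift_coeffs, Matrix.scalar]

theorem pathEvalMatrix_copyDelta_inv :
    pathEvalMatrix ρ c N
        (((copyDelta F m (k + 1))⁻¹ : (Matrix _ _ (CopyAlg F m (k + 1)))ˣ) : Matrix _ _ _) =
      Matrix.diagonal fun i => Matrix.diagonal
        fun _ : Fin (k + 1) => (ρ i).toAlgHom ((basept F m)⁻¹ : (KnotAlg F m)ˣ) := by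
  have h : pathEvalMatrix ρ c N
        (((copyDelta F m (k + 1))⁻¹ : (Matrix _ _ (CopyAlg F m (k + 1)))ˣ) : Matrix _ _ _) *
      pathEvalMatrix ρ c N (copyDelta F m (k + 1) : Matrix _ _ _) = 1 := by
    rw [← map_mul, Units.inv_mul, map_one]
  refine left_inv_eq_right_inv h ?_
  rw [pathEvalMatrix_copyDelta, Matrix.diagonal_mul_diagonal]
  simp only [Matrix.diagonal_mul_diagonal, ← map_mul, Units.mul_inv, map_one, Matrix.diagonal_one]

end PathEvaluation

/-! ### The entries of `Φ` along paths. -/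

section PathEntries

variable {F : Type*} [Field F] {m : ℕ} {D : KnotDGA F m} {n k : ℕ}
variable (ρ : Fin (k + 1) → Rep D n) (c : Fin k → HomGen m) (N : Fin k → Mat n F)

theorem isPathMatrix_copyX_inv : IsPathMatrix 1 (pathEvalMatrix ρ c N
    (((isUnit_copyX F m (k + 1)).unit⁻¹ : (Matrix _ _ (CopyAlg F m (k + 1)))ˣ) :
      Matrix _ _ (CopyAlg F m (k + 1)))) := by
  refine (isPathMatrix_copyXStrict ρ c N).inverse_one_add ?_ ?_
  · refine IsNilpotent.map ⟨k + 1, ?_⟩ _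
    refine Matrix.ext fun i j => ?_
    exact copyXStrict_pow_apply F m (k + 1) (k + 1) i j (by omega)
  · rw [← map_one (pathEvalMatrix ρ c N), ← map_add, ← map_mul]
    exact congrArg _ (Units.mul_inv (isUnit_copyX F m (k + 1)).unit)

/-- The evaluation of the matrix `Φ(u)`. -/
noncomputable def pathEvalPhi : KnotAlg F m →ₐ[F]
    Matrix (Fin (k + 1)) (Fin (k + 1)) (Matrix (Fin (k + 1)) (Fin (k + 1)) (Mat n F)) :=
  (pathEvalMatrix ρ c N).comp (copyPhi F m (k + 1))

theorem pathEvalPhi_chord (l : Fin m) :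
    pathEvalPhi ρ c N (chord l) = pathEvalMatrix ρ c N (copyA F m (k + 1) l) := by
  simp [pathEvalPhi, copyPhi, chord, FreeAlg.lift_gen]

theorem pathEvalPhi_basept : pathEvalPhi ρ c N (basept F m) =
    pathEvalMatrix ρ c N (copyDelta F m (k + 1) : Matrix _ _ _) *
      (1 + pathEvalMatrix ρ c N (copyXStrict F m (k + 1))) := by
  simp [pathEvalPhi, copyPhi, basept, FreeAlg.lift_unit, copyX]

theorem pathEvalPhi_basept_inv :
    pathEvalPhi ρ c N ((basept F m)⁻¹ : (KnotAlg F m)ˣ) =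
      pathEvalMatrix ρ c N (((isUnit_copyX F m (k + 1)).unit⁻¹ :
        (Matrix _ _ (CopyAlg F m (k + 1)))ˣ) : Matrix _ _ (CopyAlg F m (k + 1))) *
      pathEvalMatrix ρ c N
        (((copyDelta F m (k + 1))⁻¹ : (Matrix _ _ (CopyAlg F m (k + 1)))ˣ) : Matrix _ _ _) := by
  have h : pathEvalPhi ρ c N ((basept F m)⁻¹ : (KnotAlg F m)ˣ) *
      pathEvalPhi ρ c N (basept F m) = 1 := by
    rw [← map_mul, Units.inv_mul, map_one]
  refine left_inv_eq_right_inv h ?_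
  have h2 : pathEvalPhi ρ c N (basept F m) = pathEvalMatrix ρ c N
      ((copyDelta F m (k + 1) * (isUnit_copyX F m (k + 1)).unit :
        (Matrix _ _ (CopyAlg F m (k + 1)))ˣ) : Matrix _ _ (CopyAlg F m (k + 1))) := by
    rw [pathEvalPhi, copyPhi, AlgHom.comp_apply, basept, FreeAlg.lift_unit]
  rw [h2, ← map_mul, ← map_mul, ← Units.val_mul, ← mul_inv_rev, Units.mul_inv, map_one]

/-- Path matrices are closed under products, so the generators suffice; the case of `t⁻¹` is where
the geometric series for `X⁻¹` enters. -/
theorem isPathMatrix_pathEvalPhi (w : Word m) :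
    IsPathMatrix (fun i => (ρ i).toAlgHom (word F w)) (pathEvalPhi ρ c N (word F w)) := by
  induction w using Word.induction with
  | one => simpa using! IsPathMatrix.one (A := Mat n F) (K := k + 1)
  | mul v w hv hw =>
    simp only [map_mul]
    exact hv.mul hw
  | chord l =>
    rw [word_chord, pathEvalPhi_chord]
    exact isPathMatrix_copyA ρ c N l
  | basept =>
    rw [word_basept, pathEvalPhi_basept, pathEvalMatrix_copyDelta]
    have h := (IsPathMatrix.diagonal fun i => (ρ i).toAlgHom (basept F m : KnotAlg F m)).mul
      (IsPathMatrix.one.add (isPathMatrix_copyXStrict ρ c N))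
    simpa using h
  | basept_inv =>
    rw [word_basept_inv, pathEvalPhi_basept_inv, pathEvalMatrix_copyDelta_inv]
    have h := (isPathMatrix_copyX_inv ρ c N).mul (IsPathMatrix.diagonal fun i =>
      (ρ i).toAlgHom (((basept F m)⁻¹ : (KnotAlg F m)ˣ) : KnotAlg F m))
    simpa using h

/-- The sum of the path terms from `i` to `j` of the entry `Φ(u)^{ij}`. -/
noncomputable def pathEntry (i j : Fin (k + 1)) : KnotAlg F m →ₗ[F] Mat n F where
  toFun u := pathEvalPhi ρ c N u i j i j
  map_add' u v := by simp
  map_smul' r u := by simp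

/-- This is the source of both product rules: for two components the sum gives a derivation, and for
three components its middle term is the product of two linear parts. -/
theorem pathEntry_mul (i j : Fin (k + 1)) (v w : Word m) :
    pathEntry ρ c N i j (word F (v * w)) =
      ∑ l, pathEntry ρ c N i l (word F v) * pathEntry ρ c N l j (word F w) := by
  simp only [pathEntry, LinearMap.coe_mk, AddHom.coe_mk, map_mul]
  exact (isPathMatrix_pathEvalPhi ρ c N v).mul_apply i j

theorem pathEntry_self (i : Fin (k + 1)) (w : Word m) :
    pathEntry ρ c N i i (word F w) = (ρ i).toAlgHom (word F w) :=
  (isPathMatrix_pathEvalPhi ρ c N w).diag i i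

theorem pathEntry_of_lt {i j : Fin (k + 1)} (h : j < i) (w : Word m) :
    pathEntry ρ c N i j (word F w) = 0 :=
  (isPathMatrix_pathEvalPhi ρ c N w).apply_of_lt h i j

theorem pathEntry_chord (l : Fin m) {i j : Fin (k + 1)} (h : i < j) :
    pathEntry ρ c N i j (chord l) = pathGen c N ((HomGen.a l).copy i j h) i j := by
  simp [pathEntry, pathEvalPhi_chord, pathEvalMatrix_copyA_apply, h, h.ne]

theorem diagonal_mul_apply_apply {A : Type*} [Ring A] {K : ℕ} (d : Fin K → A)
    (M : Matrix (Fin K) (Fin K) (Matrix (Fin K) (Fin K) A)) (i j p q : Fin K) :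
    ((Matrix.diagonal fun i => Matrix.diagonal fun _ => d i :
      Matrix (Fin K) (Fin K) (Matrix (Fin K) (Fin K) A)) * M) i j p q = d i * M i j p q := by
  rw [Matrix.diagonal_mul, Matrix.diagonal_mul]

theorem mul_diagonal_apply_apply {A : Type*} [Ring A] {K : ℕ} (d : Fin K → A)
    (M : Matrix (Fin K) (Fin K) (Matrix (Fin K) (Fin K) A)) (i j p q : Fin K) :
    (M * (Matrix.diagonal fun i => Matrix.diagonal fun _ => d i :
      Matrix (Fin K) (Fin K) (Matrix (Fin K) (Fin K) A))) i j p q = M i j p q * d j := by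
  rw [Matrix.mul_diagonal, Matrix.mul_diagonal]

theorem pathEntry_basept {i j : Fin (k + 1)} (h : i < j) :
    pathEntry ρ c N i j (basept F m) =
      (ρ i).toAlgHom (basept F m) * pathGen c N (HomGen.x.copy i j h) i j := by
  simp only [pathEntry, LinearMap.coe_mk, AddHom.coe_mk, pathEvalPhi_basept,
    pathEvalMatrix_copyDelta, diagonal_mul_apply_apply]
  simp [pathEvalMatrix_copyXStrict_apply, h, h.ne]

/-- Path letters join consecutive components only, so in the 3-copy the generators `c^{02}`
contribute nothing. -/
theorem pathGen_copy_of_ne {i j p q : Fin (k + 1)} (h : i < j) (c' : HomGen m)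
    (hj : (j : ℕ) ≠ i + 1) : pathGen c N (c'.copy i j h) p q = 0 := by
  by_contra h0
  exact hj (pathGen_copy_ne_zero c N h0).2.2

end PathEntries

/-! ### The linear and quadratic parts of `Φ`. -/

section Linearization

variable {F : Type*} [Field F] {m : ℕ} {D : KnotDGA F m} {n : ℕ} {ρ₁ ρ₂ ρ₃ : Rep D n}

theorem pathGen_one (c c' : HomGen m) (N : Mat n F) :
    pathGen ![c] ![N] (c'.copy 0 1 Fin.zero_lt_one) 0 1 = if c = c' then N else 0 :=
  pathGen_copy_apply ![c] ![N] c' 0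

theorem pathGen_two_left (c₁ c₂ c' : HomGen m) (M N : Mat n F) :
    pathGen ![c₁, c₂] ![M, N] (c'.copy 0 1 Fin.zero_lt_one) 0 1 = if c₂ = c' then M else 0 :=
  pathGen_copy_apply ![c₁, c₂] ![M, N] c' 0

theorem pathGen_two_right (c₁ c₂ c' : HomGen m) (M N : Mat n F) :
    pathGen ![c₁, c₂] ![M, N] (c'.copy 1 2 (by decide)) 1 2 = if c₁ = c' then N else 0 :=
  pathGen_copy_apply ![c₁, c₂] ![M, N] c' 1

/-- `f` is the derivation with values `α(a_l)` on the chords and `ρ₁(t) α(x)` on `t`. -/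
structure IsLinearization (α : Hom ρ₁ ρ₂) (f : KnotAlg F m →ₗ[F] Mat n F) : Prop where
  deriv : IsTwistedDerivation ρ₁.toAlgHom ρ₂.toAlgHom 0 f
  chord : ∀ l, f (chord l) = α (.a l)
  basept : f (basept F m) = ρ₁.toAlgHom (basept F m) * α .x

theorem IsLinearization.ext {α : Hom ρ₁ ρ₂} {f g : KnotAlg F m →ₗ[F] Mat n F}
    (hf : IsLinearization α f) (hg : IsLinearization α g) : f = g :=
  hf.deriv.ext hg.deriv (fun l => by rw [hf.chord, hg.chord]) (by rw [hf.basept, hg.basept])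

theorem IsLinearization.sum {ι : Type*} (s : Finset ι) {α : ι → Hom ρ₁ ρ₂}
    {f : ι → KnotAlg F m →ₗ[F] Mat n F} (hf : ∀ i, IsLinearization (α i) (f i)) :
    IsLinearization (ρ₁ := ρ₁) (ρ₂ := ρ₂) (∑ i ∈ s, α i) (∑ i ∈ s, f i) where
  deriv v w := by
    simp only [LinearMap.sum_apply, (hf _).deriv v w, Pi.zero_apply, add_zero,
      Finset.sum_add_distrib, Finset.mul_sum, Finset.sum_mul]
  chord l := by simp [LinearMap.sum_apply, (hf _).chord]
  basept := by simp [LinearMap.sum_apply, (hf _).basept, Finset.mul_sum]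

theorem isLinearization_pathEntry (c : HomGen m) (N : Mat n F) :
    IsLinearization (ρ₁ := ρ₁) (ρ₂ := ρ₂) (Pi.single c N)
      (pathEntry ![ρ₁, ρ₂] ![c] ![N] 0 1) where
  deriv v w := by
    have h := pathEntry_mul ![ρ₁, ρ₂] ![c] ![N] 0 1 v w
    rw [Fin.sum_univ_two, pathEntry_self, pathEntry_self] at h
    simpa using h
  chord l := by
    rw [pathEntry_chord (h := Fin.zero_lt_one), pathGen_one]
    simp [Pi.single_apply, eq_comm]
  basept := by
    rw [pathEntry_basept (h := Fin.zero_lt_one), pathGen_one]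
    simp [Pi.single_apply, eq_comm]

/-- The linear part of `Φ(u)^{12}` evaluated at `α`. -/
noncomputable def linearization (α : Hom ρ₁ ρ₂) : KnotAlg F m →ₗ[F] Mat n F :=
  ∑ c : HomGen m, pathEntry ![ρ₁, ρ₂] ![c] ![α c] 0 1

theorem isLinearization_linearization (α : Hom ρ₁ ρ₂) :
    IsLinearization α (linearization α) := by
  have h := IsLinearization.sum (ρ₁ := ρ₁) (ρ₂ := ρ₂) Finset.univ
    fun c => isLinearization_pathEntry (ρ₁ := ρ₁) (ρ₂ := ρ₂) c (α c)
  rwa [Finset.univ_sum_single α] at h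

theorem linearization_single (c : HomGen m) (N : Mat n F) :
    linearization (ρ₁ := ρ₁) (ρ₂ := ρ₂) (Pi.single c N) = pathEntry ![ρ₁, ρ₂] ![c] ![N] 0 1 :=
  (isLinearization_linearization _).ext (isLinearization_pathEntry c N)

theorem sum_linearization_single (α : Hom ρ₁ ρ₂) :
    ∑ c, linearization (ρ₁ := ρ₁) (ρ₂ := ρ₂) (Pi.single c (α c)) = linearization α := by
  simp only [linearization_single]
  rfl

/-- `f` is the twisted derivation with correction term given by the linearizations of `α` and `β`
which vanishes on the generators. -/
structure IsQuadraticPart (β : Hom ρ₂ ρ₃) (α : Hom ρ₁ ρ₂) (f : KnotAlg F m →ₗ[F] Mat n F) :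
    Prop where
  deriv : IsTwistedDerivation ρ₁.toAlgHom ρ₃.toAlgHom
    (fun v w => linearization α (word F v) * linearization β (word F w)) f
  chord : ∀ l, f (chord l) = 0
  basept : f (basept F m) = 0

theorem IsQuadraticPart.ext {β : Hom ρ₂ ρ₃} {α : Hom ρ₁ ρ₂} {f g : KnotAlg F m →ₗ[F] Mat n F}
    (hf : IsQuadraticPart β α f) (hg : IsQuadraticPart β α g) : f = g :=
  hf.deriv.ext hg.deriv (fun l => by rw [hf.chord, hg.chord]) (by rw [hf.basept, hg.basept])

/-- In the sum over the intermediate component, the two ends give the actions of `ρ₁` and `ρ₃`, and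
the middle gives the entries `0 → 1` and `1 → 2`, which are linearizations of the two single-letter
morphisms. The list of generators is read from the right, so the first step carries `c₂` with
coefficient `M`. -/
theorem isQuadraticPart_pathEntry (c₁ c₂ : HomGen m) (M N : Mat n F) :
    IsQuadraticPart (ρ₁ := ρ₁) (ρ₂ := ρ₂) (ρ₃ := ρ₃) (Pi.single c₁ N) (Pi.single c₂ M)
      (pathEntry ![ρ₁, ρ₂, ρ₃] ![c₁, c₂] ![M, N] 0 2) where
  deriv v w := by
    have h1 : IsLinearization (ρ₁ := ρ₁) (ρ₂ := ρ₂) (Pi.single c₂ M)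
        (pathEntry ![ρ₁, ρ₂, ρ₃] ![c₁, c₂] ![M, N] 0 1) :=
      { deriv := fun v w => by
          have h := pathEntry_mul ![ρ₁, ρ₂, ρ₃] ![c₁, c₂] ![M, N] 0 1 v w
          rw [Fin.sum_univ_three, pathEntry_self, pathEntry_self,
            pathEntry_of_lt (i := 2) (j := 1) (h := by decide)] at h
          simpa using h
        chord := fun l => by
          rw [pathEntry_chord (h := Fin.zero_lt_one), pathGen_two_left]
          simp [Pi.single_apply, eq_comm]
        basept := by
          rw [pathEntry_basept (h := Fin.zero_lt_one), pathGen_two_left]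
          simp [Pi.single_apply, eq_comm] }
    have h2 : IsLinearization (ρ₁ := ρ₂) (ρ₂ := ρ₃) (Pi.single c₁ N)
        (pathEntry ![ρ₁, ρ₂, ρ₃] ![c₁, c₂] ![M, N] 1 2) :=
      { deriv := fun v w => by
          have h := pathEntry_mul ![ρ₁, ρ₂, ρ₃] ![c₁, c₂] ![M, N] 1 2 v w
          rw [Fin.sum_univ_three, pathEntry_self, pathEntry_self,
            pathEntry_of_lt (i := 1) (j := 0) (h := by decide)] at h
          simpa using h
        chord := fun l => by
          rw [pathEntry_chord (h := by decide), pathGen_two_right]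
          simp [Pi.single_apply, eq_comm]
        basept := by
          rw [pathEntry_basept (h := by decide), pathGen_two_right]
          simp [Pi.single_apply, eq_comm] }
    have h := pathEntry_mul ![ρ₁, ρ₂, ρ₃] ![c₁, c₂] ![M, N] 0 2 v w
    rw [Fin.sum_univ_three, pathEntry_self, pathEntry_self,
      h1.ext (isLinearization_linearization _), h2.ext (isLinearization_linearization _)] at h
    simpa using h
  chord l := by
    rw [pathEntry_chord (h := by decide), pathGen_copy_of_ne (hj := by decide)]
  basept := by
    rw [pathEntry_basept (h := by decide), pathGen_copy_of_ne (hj := by decide), mul_zero]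

/-- The quadratic part of `Φ(u)^{13}` evaluated at `α` and `β`. -/
noncomputable def quadraticPart (β : Hom ρ₂ ρ₃) (α : Hom ρ₁ ρ₂) : KnotAlg F m →ₗ[F] Mat n F :=
  ∑ c₁ : HomGen m, ∑ c₂ : HomGen m, pathEntry ![ρ₁, ρ₂, ρ₃] ![c₁, c₂] ![α c₂, β c₁] 0 2

theorem isQuadraticPart_quadraticPart (β : Hom ρ₂ ρ₃) (α : Hom ρ₁ ρ₂) :
    IsQuadraticPart β α (quadraticPart β α) where
  deriv v w := by
    have h c₁ c₂ := isQuadraticPart_pathEntry (ρ₁ := ρ₁) (ρ₂ := ρ₂) (ρ₃ := ρ₃)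
      c₁ c₂ (α c₂) (β c₁)
    rw [← sum_linearization_single α, ← sum_linearization_single β]
    simp only [quadraticPart, LinearMap.sum_apply, (h _ _).deriv v w, Finset.sum_add_distrib,
      Finset.mul_sum, Finset.sum_mul]
  chord l := by
    simp [quadraticPart, LinearMap.sum_apply, (isQuadraticPart_pathEntry _ _ _ _).chord]
  basept := by
    simp [quadraticPart, LinearMap.sum_apply, (isQuadraticPart_pathEntry _ _ _ _).basept]

end Linearization

/-! ### The differential of the copy along paths. -/

section Evaluation

variable {F : Type*} [Field F] {m : ℕ} {D : KnotDGA F m} {n k : ℕ}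
variable (ρ : Fin (k + 1) → Rep D n) (c : Fin k → HomGen m) (N : Fin k → Mat n F)

/-- Definitional: `substWord` is the corner entry of `pathHom`, and composing `pathHom` with the
twist is `pathEval`. -/
theorem mk_apply (α : (p : Fin k) → Hom (ρ p.rev.castSucc) (ρ p.rev.succ)) (b : HomGen m) :
    mk ρ α b = ∑ c : Fin k → HomGen m, (Int.negOnePow (signExp D c)) •
      pathEvalMatrix ρ c (fun j => α j.rev (c j.rev)) (copyDiff D (k + 1) b)
        0 (Fin.last k) 0 (Fin.last k) := rfl

theorem pathEvalMatrix_copyDiff_a (l : Fin m) (i j : Fin (k + 1)) :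
    pathEvalMatrix ρ c N (copyDiff D (k + 1) (.a l)) i j i j =
      pathEntry ρ c N i j (D.d (chord l)) +
      (∑ r, pathEvalMatrix ρ c N (copyY F m (k + 1)) i r i r *
        pathEvalMatrix ρ c N (copyA F m (k + 1) l) r j r j) -
      (Int.negOnePow (D.deg l)) • ∑ r, pathEvalMatrix ρ c N (copyA F m (k + 1) l) i r i r *
        pathEvalMatrix ρ c N (copyY F m (k + 1)) r j r j := by
  rw [← (isPathMatrix_copyY ρ c N).mul_apply, ← (isPathMatrix_copyA ρ c N l).mul_apply]
  simp only [copyDiff, Units.smul_def, map_sub, map_add, map_mul, map_zsmul]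
  rfl

theorem pathEvalMatrix_copyDiff_x (i j : Fin (k + 1)) :
    pathEvalMatrix ρ c N (copyDiff D (k + 1) .x) i j i j =
      (∑ r, (ρ i).toAlgHom ((basept F m)⁻¹ : (KnotAlg F m)ˣ) *
        pathEvalMatrix ρ c N (copyY F m (k + 1)) i r i r * (ρ r).toAlgHom (basept F m) *
        pathEvalMatrix ρ c N (copyX F m (k + 1)) r j r j) -
      ∑ r, pathEvalMatrix ρ c N (copyX F m (k + 1)) i r i r *
        pathEvalMatrix ρ c N (copyY F m (k + 1)) r j r j := by
  have hX : IsPathMatrix 1 (pathEvalMatrix ρ c N (copyX F m (k + 1))) := by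
    have h := IsPathMatrix.one.add (isPathMatrix_copyXStrict ρ c N)
    rw [add_zero] at h
    rwa [copyX, map_add, map_one]
  have hY := isPathMatrix_copyY ρ c N
  rw [← hX.mul_apply]
  simp only [copyDiff, map_sub, map_mul, pathEvalMatrix_copyDelta, pathEvalMatrix_copyDelta_inv]
  rw [Matrix.sub_apply, Matrix.sub_apply]
  congr 1
  rw [(((IsPathMatrix.diagonal fun i => (ρ i).toAlgHom
    (((basept F m)⁻¹ : (KnotAlg F m)ˣ) : KnotAlg F m)).mul hY).mul
    (IsPathMatrix.diagonal fun i => (ρ i).toAlgHom (basept F m : KnotAlg F m))).mul_apply]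
  simp only [mul_diagonal_apply_apply, diagonal_mul_apply_apply]

theorem pathEvalMatrix_copyDiff_y (i j : Fin (k + 1)) :
    pathEvalMatrix ρ c N (copyDiff D (k + 1) .y) i j i j =
      ∑ r, pathEvalMatrix ρ c N (copyY F m (k + 1)) i r i r *
        pathEvalMatrix ρ c N (copyY F m (k + 1)) r j r j := by
  rw [← (isPathMatrix_copyY ρ c N).mul_apply, copyDiff, map_mul]

theorem pathEvalMatrix_copyY_apply_of_lt {i j : Fin (k + 1)} (h : i < j) :
    pathEvalMatrix ρ c N (copyY F m (k + 1)) i j i j =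
      pathGen c N (HomGen.y.copy i j h) i j := by
  rw [pathEvalMatrix_copyY_apply, dif_pos h]

theorem pathEvalMatrix_copyY_apply_of_not_lt {i j : Fin (k + 1)} (h : ¬ i < j) :
    pathEvalMatrix ρ c N (copyY F m (k + 1)) i j i j = 0 := by
  rw [pathEvalMatrix_copyY_apply, dif_neg h]
  rfl

theorem pathEvalMatrix_copyX_apply_of_lt {i j : Fin (k + 1)} (h : i < j) :
    pathEvalMatrix ρ c N (copyX F m (k + 1)) i j i j =
      pathGen c N (HomGen.x.copy i j h) i j := by
  simp [copyX, pathEvalMatrix_copyXStrict_apply, h, h.ne]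

theorem pathEvalMatrix_copyX_apply_self (i : Fin (k + 1)) :
    pathEvalMatrix ρ c N (copyX F m (k + 1)) i i i i = 1 := by
  simp [copyX, pathEvalMatrix_copyXStrict_apply]

theorem pathEvalMatrix_copyA_apply_of_lt (l : Fin m) {i j : Fin (k + 1)} (h : i < j) :
    pathEvalMatrix ρ c N (copyA F m (k + 1) l) i j i j =
      pathGen c N ((HomGen.a l).copy i j h) i j := by
  simp [pathEvalMatrix_copyA_apply, h, h.ne]

theorem pathEvalMatrix_copyA_apply_self (l : Fin m) (i : Fin (k + 1)) :
    pathEvalMatrix ρ c N (copyA F m (k + 1) l) i i i i = (ρ i).toAlgHom (chord l) :=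
  (isPathMatrix_copyA ρ c N l).diag i i

end Evaluation

/-! ### Explicit formulas for `m₁` and `m₂`. -/

section Compositions

variable {F : Type*} [Field F] {m : ℕ} {D : KnotDGA F m} {n : ℕ} {ρ₁ ρ₂ ρ₃ : Rep D n}

theorem m₁_apply (α : Hom ρ₁ ρ₂) (b : HomGen m) :
    m₁ α b = ∑ c, pathEvalMatrix ![ρ₁, ρ₂] ![c] ![α c] (copyDiff D 2 b) 0 1 0 1 := by
  rw [m₁, mk_apply]
  refine (Fintype.sum_equiv (Equiv.funUnique (Fin 1) (HomGen m)).symm _ _ fun c => ?_).symm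
  have hc : (Equiv.funUnique (Fin 1) (HomGen m)).symm c = ![c] := by
    funext i
    fin_cases i
    rfl
  have hs : signExp D ![c] = 0 := by simp [signExp]
  have hN : (fun j : Fin 1 => (![α] : (p : Fin 1) → Hom (![ρ₁, ρ₂] p.rev.castSucc)
      (![ρ₁, ρ₂] p.rev.succ)) j.rev ((![c] : Fin 1 → HomGen m) j.rev)) = ![α c] := by
    funext i
    fin_cases i
    rfl
  rw [hc, hs, Int.negOnePow_zero, one_smul, hN]
  rfl

theorem m₂_apply (β : Hom ρ₂ ρ₃) (α : Hom ρ₁ ρ₂) (b : HomGen m) :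
    m₂ β α b = ∑ c₁, ∑ c₂,
      Int.negOnePow (1 + dualDeg D c₁ * dualDeg D c₂ + dualDeg D c₂) •
        pathEvalMatrix ![ρ₁, ρ₂, ρ₃] ![c₁, c₂] ![α c₂, β c₁] (copyDiff D 3 b) 0 2 0 2 := by
  rw [m₂, mk_apply, ← Fintype.sum_prod_type']
  refine (Fintype.sum_equiv (finTwoArrowEquiv (HomGen m)).symm _ _ fun c => ?_).symm
  obtain ⟨c₁, c₂⟩ := c
  have hc : (finTwoArrowEquiv (HomGen m)).symm (c₁, c₂) = ![c₁, c₂] := rfl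
  have hs : signExp D ![c₁, c₂] = 1 + dualDeg D c₁ * dualDeg D c₂ + dualDeg D c₂ := by
    simp [signExp, Fin.sum_univ_two]
  have hN : (fun j : Fin 2 => (![β, α] : (p : Fin 2) → Hom (![ρ₁, ρ₂, ρ₃] p.rev.castSucc)
      (![ρ₁, ρ₂, ρ₃] p.rev.succ)) j.rev ((![c₁, c₂] : Fin 2 → HomGen m) j.rev)) =
      ![α c₂, β c₁] := by
    funext i
    fin_cases i <;> rfl
  rw [hc, hs, hN]
  rfl

/-- The differential `∂Y = Y²` has no linear term. Hence coboundaries never change the coefficient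
of `y^∨`. -/
theorem m₁_y (α : Hom ρ₁ ρ₂) : m₁ α .y = 0 := by
  rw [m₁_apply]
  refine Finset.sum_eq_zero fun c _ => ?_
  rw [pathEvalMatrix_copyDiff_y, Fin.sum_univ_two,
    pathEvalMatrix_copyY_apply_of_not_lt (i := 0) (j := 0) (h := by decide),
    pathEvalMatrix_copyY_apply_of_not_lt (i := 1) (j := 1) (h := by decide)]
  simp

theorem m₁_x (α : Hom ρ₁ ρ₂) : m₁ α .x =
    ρ₁.toAlgHom ((basept F m)⁻¹ : (KnotAlg F m)ˣ) * α .y * ρ₂.toAlgHom (basept F m) - α .y := by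
  have h c : pathEvalMatrix ![ρ₁, ρ₂] ![c] ![α c] (copyDiff D 2 .x) 0 1 0 1 =
      if c = HomGen.y then ρ₁.toAlgHom ((basept F m)⁻¹ : (KnotAlg F m)ˣ) * α .y *
        ρ₂.toAlgHom (basept F m) - α .y else 0 := by
    rw [pathEvalMatrix_copyDiff_x, Fin.sum_univ_two, Fin.sum_univ_two,
      pathEvalMatrix_copyY_apply_of_not_lt (i := 0) (j := 0) (h := by decide),
      pathEvalMatrix_copyY_apply_of_not_lt (i := 1) (j := 1) (h := by decide),
      pathEvalMatrix_copyY_apply_of_lt (h := Fin.zero_lt_one), pathGen_one,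
      pathEvalMatrix_copyX_apply_self, pathEvalMatrix_copyX_apply_self]
    by_cases hc : c = .y
    · subst hc
      simp
    · simp [hc]
  rw [m₁_apply, Finset.sum_congr rfl fun c _ => h c]
  simp

theorem m₁_a (α : Hom ρ₁ ρ₂) (l : Fin m) : m₁ α (.a l) =
    linearization α (D.d (chord l)) + α .y * ρ₂.toAlgHom (chord l) -
      Int.negOnePow (D.deg l) • (ρ₁.toAlgHom (chord l) * α .y) := by
  have h c : pathEvalMatrix ![ρ₁, ρ₂] ![c] ![α c] (copyDiff D 2 (.a l)) 0 1 0 1 =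
      pathEntry ![ρ₁, ρ₂] ![c] ![α c] 0 1 (D.d (chord l)) +
      if c = HomGen.y then α .y * ρ₂.toAlgHom (chord l) -
        Int.negOnePow (D.deg l) • (ρ₁.toAlgHom (chord l) * α .y) else 0 := by
    rw [pathEvalMatrix_copyDiff_a, Fin.sum_univ_two, Fin.sum_univ_two,
      pathEvalMatrix_copyY_apply_of_not_lt (i := 0) (j := 0) (h := by decide),
      pathEvalMatrix_copyY_apply_of_not_lt (i := 1) (j := 1) (h := by decide),
      pathEvalMatrix_copyY_apply_of_lt (h := Fin.zero_lt_one), pathGen_one,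
      pathEvalMatrix_copyA_apply_self, pathEvalMatrix_copyA_apply_self]
    by_cases hc : c = .y
    · subst hc
      simp [add_sub_assoc]
    · simp [hc]
  rw [m₁_apply, Finset.sum_congr rfl fun c _ => h c, Finset.sum_add_distrib]
  simp [linearization, LinearMap.sum_apply, add_sub_assoc]

/-- Both sides are derivations with the same values on generators. The same uniqueness argument
gives the other linearity statements for `linearization` and `quadraticPart`. -/
theorem linearization_add (α α' : Hom ρ₁ ρ₂) :
    linearization (ρ₁ := ρ₁) (ρ₂ := ρ₂) (α + α') = linearization α + linearization α' := by
  have h := isLinearization_linearization α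
  have h' := isLinearization_linearization α'
  refine (isLinearization_linearization _).ext ⟨fun v w => ?_, fun l => ?_, ?_⟩
  · simp only [LinearMap.add_apply, h.deriv v w, h'.deriv v w, Pi.zero_apply]
    noncomm_ring
  · simp [h.chord, h'.chord]
  · simp [h.basept, h'.basept, mul_add]

theorem linearization_smul (r : F) (α : Hom ρ₁ ρ₂) :
    linearization (ρ₁ := ρ₁) (ρ₂ := ρ₂) (r • α) = r • linearization α := by
  have h := isLinearization_linearization α
  refine (isLinearization_linearization _).ext ⟨fun v w => ?_, fun l => ?_, ?_⟩
  · simp only [LinearMap.smul_apply, h.deriv v w, Pi.zero_apply]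
    simp
  · simp [h.chord]
  · simp [h.basept]

theorem quadraticPart_add_left (β β' : Hom ρ₂ ρ₃) (α : Hom ρ₁ ρ₂) :
    quadraticPart (ρ₂ := ρ₂) (ρ₃ := ρ₃) (β + β') α = quadraticPart β α + quadraticPart β' α := by
  have h := isQuadraticPart_quadraticPart β α
  have h' := isQuadraticPart_quadraticPart β' α
  refine (isQuadraticPart_quadraticPart _ _).ext ⟨fun v w => ?_, fun l => ?_, ?_⟩
  · simp only [LinearMap.add_apply, h.deriv v w, h'.deriv v w, linearization_add]
    noncomm_ring
  · simp [h.chord, h'.chord]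
  · simp [h.basept, h'.basept]

theorem quadraticPart_add_right (β : Hom ρ₂ ρ₃) (α α' : Hom ρ₁ ρ₂) :
    quadraticPart (ρ₁ := ρ₁) (ρ₂ := ρ₂) β (α + α') = quadraticPart β α + quadraticPart β α' := by
  have h := isQuadraticPart_quadraticPart β α
  have h' := isQuadraticPart_quadraticPart β α'
  refine (isQuadraticPart_quadraticPart _ _).ext ⟨fun v w => ?_, fun l => ?_, ?_⟩
  · simp only [LinearMap.add_apply, h.deriv v w, h'.deriv v w, linearization_add]
    noncomm_ring
  · simp [h.chord, h'.chord]
  · simp [h.basept, h'.basept]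

theorem quadraticPart_smul_left (r : F) (β : Hom ρ₂ ρ₃) (α : Hom ρ₁ ρ₂) :
    quadraticPart (ρ₂ := ρ₂) (ρ₃ := ρ₃) (r • β) α = r • quadraticPart β α := by
  have h := isQuadraticPart_quadraticPart β α
  refine (isQuadraticPart_quadraticPart _ _).ext ⟨fun v w => ?_, fun l => ?_, ?_⟩
  · simp only [LinearMap.smul_apply, h.deriv v w, linearization_smul]
    simp
  · simp [h.chord]
  · simp [h.basept]

theorem quadraticPart_smul_right (r : F) (β : Hom ρ₂ ρ₃) (α : Hom ρ₁ ρ₂) :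
    quadraticPart (ρ₁ := ρ₁) (ρ₂ := ρ₂) β (r • α) = r • quadraticPart β α := by
  have h := isQuadraticPart_quadraticPart β α
  refine (isQuadraticPart_quadraticPart _ _).ext ⟨fun v w => ?_, fun l => ?_, ?_⟩
  · simp only [LinearMap.smul_apply, h.deriv v w, linearization_smul]
    simp
  · simp [h.chord]
  · simp [h.basept]

theorem quadraticPart_single (c₁ c₂ : HomGen m) (M N : Mat n F) :
    quadraticPart (ρ₁ := ρ₁) (ρ₂ := ρ₂) (ρ₃ := ρ₃) (Pi.single c₁ N) (Pi.single c₂ M) =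
      pathEntry ![ρ₁, ρ₂, ρ₃] ![c₁, c₂] ![M, N] 0 2 :=
  (isQuadraticPart_quadraticPart _ _).ext (isQuadraticPart_pathEntry c₁ c₂ M N)

/-- The composition `m₂` without its sign. -/
noncomputable def unsignedComp (β : Hom ρ₂ ρ₃) (α : Hom ρ₁ ρ₂) : Hom ρ₁ ρ₃
  | .y => α .y * β .y
  | .x => ρ₁.toAlgHom ((basept F m)⁻¹ : (KnotAlg F m)ˣ) * α .y * ρ₂.toAlgHom (basept F m) * β .x -
      α .x * β .y
  | .a l => quadraticPart β α (D.d (chord l)) + α .y * β (.a l) -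
      Int.negOnePow (D.deg l) • (α (.a l) * β .y)

/-- The bilinear map underlying `unsignedComp`. -/
noncomputable def unsignedCompHom (ρ₁ ρ₂ ρ₃ : Rep D n) :
    (HomGen m → Mat n F) →ₗ[F] (HomGen m → Mat n F) →ₗ[F] HomGen m → Mat n F :=
  LinearMap.mk₂ F (unsignedComp (ρ₁ := ρ₁) (ρ₂ := ρ₂) (ρ₃ := ρ₃))
    (fun β β' α => by
      funext b
      cases b with
      | y => simp [unsignedComp, mul_add]
      | x => simp only [unsignedComp, Pi.add_apply, mul_add]; abel
      | a l =>
        simp only [unsignedComp, Pi.add_apply, mul_add, quadraticPart_add_left, smul_add,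
          LinearMap.add_apply]
        abel)
    (fun r β α => by
      funext b
      cases b with
      | y => simp [unsignedComp]
      | x => simp [unsignedComp, smul_sub]
      | a l =>
        simp only [unsignedComp, Pi.smul_apply, quadraticPart_smul_left, smul_add, smul_sub,
          LinearMap.smul_apply, mul_smul_comm, Units.smul_def, smul_comm r])
    (fun β α α' => by
      funext b
      cases b with
      | y => simp [unsignedComp, add_mul]
      | x => simp only [unsignedComp, Pi.add_apply, mul_add, add_mul]; abel
      | a l =>
        simp only [unsignedComp, Pi.add_apply, add_mul, quadraticPart_add_right, smul_add,
          LinearMap.add_apply]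
        abel)
    (fun r β α => by
      funext b
      cases b with
      | y => simp [unsignedComp]
      | x => simp [unsignedComp, smul_sub]
      | a l =>
        simp only [unsignedComp, Pi.smul_apply, quadraticPart_smul_right, smul_add, smul_sub,
          LinearMap.smul_apply, smul_mul_assoc, Units.smul_def, smul_comm r])

/-- This handles one pair of letters; bilinearity of `unsignedComp` then assembles all of `m₂`. -/
theorem pathEvalMatrix_copyDiff_two (c₁ c₂ : HomGen m) (M N : Mat n F) (b : HomGen m) :
    pathEvalMatrix ![ρ₁, ρ₂, ρ₃] ![c₁, c₂] ![M, N] (copyDiff D 3 b) 0 2 0 2 =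
      unsignedComp (ρ₁ := ρ₁) (ρ₂ := ρ₂) (ρ₃ := ρ₃) (Pi.single c₁ N) (Pi.single c₂ M) b := by
  have hy02 : pathEvalMatrix ![ρ₁, ρ₂, ρ₃] ![c₁, c₂] ![M, N] (copyY F m 3) 0 2 0 2 = 0 := by
    rw [pathEvalMatrix_copyY_apply_of_lt (h := by decide), pathGen_copy_of_ne (hj := by decide)]
  have hy00 := pathEvalMatrix_copyY_apply_of_not_lt ![ρ₁, ρ₂, ρ₃] ![c₁, c₂] ![M, N]
    (i := 0) (j := 0) (h := by decide)
  have hy22 := pathEvalMatrix_copyY_apply_of_not_lt ![ρ₁, ρ₂, ρ₃] ![c₁, c₂] ![M, N]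
    (i := 2) (j := 2) (h := by decide)
  cases b with
  | y =>
    rw [pathEvalMatrix_copyDiff_y, Fin.sum_univ_three, hy00, hy02, hy22,
      pathEvalMatrix_copyY_apply_of_lt (i := 0) (j := 1) (h := by decide), pathGen_two_left,
      pathEvalMatrix_copyY_apply_of_lt (i := 1) (j := 2) (h := by decide), pathGen_two_right]
    simp [unsignedComp, Pi.single_apply, eq_comm]
  | x =>
    rw [pathEvalMatrix_copyDiff_x, Fin.sum_univ_three, Fin.sum_univ_three, hy00, hy02, hy22,
      pathEvalMatrix_copyY_apply_of_lt (i := 0) (j := 1) (h := by decide), pathGen_two_left,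
      pathEvalMatrix_copyY_apply_of_lt (i := 1) (j := 2) (h := by decide), pathGen_two_right,
      pathEvalMatrix_copyX_apply_of_lt (i := 0) (j := 1) (h := by decide), pathGen_two_left,
      pathEvalMatrix_copyX_apply_of_lt (i := 1) (j := 2) (h := by decide), pathGen_two_right]
    simp [unsignedComp, Pi.single_apply, eq_comm]
  | a l =>
    rw [pathEvalMatrix_copyDiff_a, Fin.sum_univ_three, Fin.sum_univ_three, hy00, hy02, hy22,
      pathEvalMatrix_copyY_apply_of_lt (i := 0) (j := 1) (h := by decide), pathGen_two_left,
      pathEvalMatrix_copyY_apply_of_lt (i := 1) (j := 2) (h := by decide), pathGen_two_right,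
      pathEvalMatrix_copyA_apply_of_lt (i := 0) (j := 1) (h := by decide), pathGen_two_left,
      pathEvalMatrix_copyA_apply_of_lt (i := 1) (j := 2) (h := by decide), pathGen_two_right]
    simp [unsignedComp, quadraticPart_single, Pi.single_apply, eq_comm]

/-- On homogeneous elements `m₂` agrees with `unsignedComp` up to sign. -/
theorem m₂_eq {p q : ℤ} {β : Hom ρ₂ ρ₃} {α : Hom ρ₁ ρ₂} (hβ : β ∈ HomDeg q ρ₂ ρ₃)
    (hα : α ∈ HomDeg p ρ₁ ρ₂) :
    m₂ β α = Int.negOnePow (1 + q * p + p) • unsignedComp β α := by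
  funext b
  have hsum : unsignedComp β α = ∑ c₁, ∑ c₂, unsignedComp (ρ₁ := ρ₁) (ρ₂ := ρ₂) (ρ₃ := ρ₃)
      (Pi.single c₁ (β c₁)) (Pi.single c₂ (α c₂)) := by
    change unsignedCompHom ρ₁ ρ₂ ρ₃ β α = ∑ c₁, ∑ c₂, unsignedCompHom ρ₁ ρ₂ ρ₃
      (Pi.single c₁ (β c₁)) (Pi.single c₂ (α c₂))
    simp_rw [← map_sum]
    rw [← LinearMap.sum_apply, ← map_sum, Finset.univ_sum_single, Finset.univ_sum_single]
  rw [m₂_apply, hsum, Pi.smul_apply, Finset.sum_apply, Finset.smul_sum]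
  refine Finset.sum_congr rfl fun c₁ _ => ?_
  rw [Finset.sum_apply, Finset.smul_sum]
  refine Finset.sum_congr rfl fun c₂ _ => ?_
  rw [pathEvalMatrix_copyDiff_two]
  change _ • unsignedCompHom ρ₁ ρ₂ ρ₃ _ _ b = _ • unsignedCompHom ρ₁ ρ₂ ρ₃ _ _ b
  -- The sign depends on the letters only through their degrees, which equal `q` and `p` wherever
  -- the coefficients are nonzero.
  by_cases h1 : β c₁ = 0
  · simp [h1]
  by_cases h2 : α c₂ = 0
  · simp [h2]
  rw [hβ c₁ h1, hα c₂ h2]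

end Compositions

/-! ### Degrees and Koszul signs. -/

section Degrees

variable {F : Type*} [Field F] {m : ℕ} {D : KnotDGA F m} {n : ℕ} {ρ₁ ρ₂ ρ₃ : Rep D n}

/-- The degree of a word. -/
def wdeg (D : KnotDGA F m) (w : Word m) : ℤ := (FreeAlg.wordDegree D.deg w).toAdd

theorem wdeg_mul (v w : Word m) : wdeg D (v * w) = wdeg D v + wdeg D w := by simp [wdeg]

theorem wdeg_chord (l : Fin m) : wdeg D (Monoid.Coprod.inl (FreeMonoid.of l)) = D.deg l := by
  simp [wdeg, FreeAlg.wordDegree]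

theorem wdeg_inr (t : FreeGroup Unit) : wdeg D (Monoid.Coprod.inr t) = 0 := by
  simp [wdeg, FreeAlg.wordDegree]

theorem Rep.wdeg_eq_zero (ρ : Rep D n) {w : Word m} (h : ρ.toAlgHom (word F w) ≠ 0) :
    wdeg D w = 0 := by
  by_contra h0
  exact h (ρ.map_of_degree_ne_zero _ _ h0 (word_mem_homogeneous D.deg w))

/-- A representation is supported on words of degree 0, so Koszul signs disappear next to it. -/
theorem Rep.negOnePow_smul (ρ : Rep D n) (w : Word m) :
    Int.negOnePow (wdeg D w) • ρ.toAlgHom (word F w) = ρ.toAlgHom (word F w) := by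
  by_cases h : ρ.toAlgHom (word F w) = 0
  · rw [h, smul_zero]
  · rw [ρ.wdeg_eq_zero h, Int.negOnePow_zero, one_smul]

theorem KnotDGA.d_word_mul (D : KnotDGA F m) (v w : Word m) :
    D.d (word F (v * w)) =
      D.d (word F v) * word F w + Int.negOnePow (wdeg D v) • (word F v * D.d (word F w)) := by
  rw [map_mul]
  exact D.leibniz _ _ _ (word_mem_homogeneous D.deg v)

theorem KnotDGA.d_chord_mem_homogeneous (D : KnotDGA F m) (l : Fin m) :
    D.d (chord l) ∈ FreeAlg.homogeneous D.deg (D.deg l - 1) := by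
  refine D.d_mem_homogeneous _ _ ?_
  have h := word_mem_homogeneous (F := F) D.deg (Monoid.Coprod.inl (FreeMonoid.of l))
  rw [word_chord] at h
  rwa [show (FreeAlg.wordDegree D.deg (Monoid.Coprod.inl (FreeMonoid.of l))).toAdd = D.deg l
    from wdeg_chord (D := D) l] at h

theorem eq_zero_of_wdeg {p q : ℤ} {f : KnotAlg F m →ₗ[F] Mat n F}
    (hf : ∀ w, f (word F w) ≠ 0 → wdeg D w = p) {x : KnotAlg F m}
    (hx : x ∈ FreeAlg.homogeneous D.deg q) (h : f x ≠ 0) : q = p := by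
  by_contra hne
  have hle : FreeAlg.homogeneous D.deg q ≤ LinearMap.ker f := by
    refine Submodule.span_le.2 ?_
    rintro _ ⟨w, hw, rfl⟩
    refine LinearMap.mem_ker.2 ?_
    by_contra h0
    refine hne ?_
    rw [← hf w h0, wdeg, hw, toAdd_ofAdd]
  exact h (LinearMap.mem_ker.1 (hle hx))

theorem linearization_basept_inv (α : Hom ρ₁ ρ₂) :
    linearization α ((basept F m)⁻¹ : (KnotAlg F m)ˣ) =
      -(α .x * ρ₂.toAlgHom ((basept F m)⁻¹ : (KnotAlg F m)ˣ)) := by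
  have h := isLinearization_linearization α
  rw [h.deriv.map_basept_inv, h.basept, ← mul_assoc, ← map_mul, Units.inv_mul, map_one, one_mul]

theorem quadraticPart_one (β : Hom ρ₂ ρ₃) (α : Hom ρ₁ ρ₂) : quadraticPart β α 1 = 0 := by
  have h := (isQuadraticPart_quadraticPart β α).deriv.mul 1 1
  simpa [(isLinearization_linearization α).deriv.map_one] using h

/-- Expand the quadratic part of `t⁻¹ t = 1`. It vanishes on `1` and on `t`, so the correction term
determines its value on `t⁻¹`. -/
theorem quadraticPart_basept_inv (β : Hom ρ₂ ρ₃) (α : Hom ρ₁ ρ₂) :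
    quadraticPart β α ((basept F m)⁻¹ : (KnotAlg F m)ˣ) =
      α .x * (β .x * ρ₃.toAlgHom ((basept F m)⁻¹ : (KnotAlg F m)ˣ)) := by
  have h := (isQuadraticPart_quadraticPart β α).deriv.mul
    ((basept F m)⁻¹ : (KnotAlg F m)ˣ) (basept F m)
  rw [Units.inv_mul, quadraticPart_one, (isQuadraticPart_quadraticPart β α).basept, mul_zero,
    zero_add, linearization_basept_inv, (isLinearization_linearization β).basept] at h
  have h2 := congrArg (· * ρ₃.toAlgHom ((basept F m)⁻¹ : (KnotAlg F m)ˣ)) h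
  have ht : ρ₂.toAlgHom ((basept F m)⁻¹ : (KnotAlg F m)ˣ) * ρ₂.toAlgHom (basept F m) = 1 := by
    rw [← map_mul, Units.inv_mul, map_one]
  have ht' : ρ₃.toAlgHom (basept F m) * ρ₃.toAlgHom ((basept F m)⁻¹ : (KnotAlg F m)ˣ) = 1 := by
    rw [← map_mul, Units.mul_inv, map_one]
  have h3 : -(α .x * ρ₂.toAlgHom ((basept F m)⁻¹ : (KnotAlg F m)ˣ)) *
      (ρ₂.toAlgHom (basept F m) * β .x) = -(α .x * β .x) := by
    rw [neg_mul, mul_assoc, ← mul_assoc _ _ (β .x), ht, one_mul]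
  rw [h3] at h2
  simp only [zero_mul, add_mul, mul_assoc, ht', mul_one, neg_mul] at h2
  exact (neg_add_eq_zero.1 h2.symm).symm

/-- In each term of the product rule one factor is evaluated by a representation and has degree 0.
The shift by one is that of `|a_i^∨| = |a_i| + 1`. -/
theorem linearization_wdeg {p : ℤ} {α : Hom ρ₁ ρ₂} (hα : α ∈ HomDeg p ρ₁ ρ₂) (w : Word m) :
    linearization α (word F w) ≠ 0 → wdeg D w = p - 1 := by
  have hL := isLinearization_linearization α
  induction w using Word.induction with
  | one => simp [hL.deriv.map_one]
  | mul v w hv hw =>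
    intro h
    rw [hL.deriv v w, Pi.zero_apply, Pi.zero_apply, add_zero] at h
    rw [wdeg_mul]
    by_cases h1 : ρ₁.toAlgHom (word F v) * linearization α (word F w) = 0
    · rw [h1, zero_add] at h
      rw [hv (left_ne_zero_of_mul h), ρ₂.wdeg_eq_zero (right_ne_zero_of_mul h), add_zero]
    · rw [hw (right_ne_zero_of_mul h1), ρ₁.wdeg_eq_zero (left_ne_zero_of_mul h1), zero_add]
  | chord l =>
    intro h
    rw [word_chord, hL.chord] at h
    have h1 := hα _ h
    rw [wdeg_chord, ← h1]
    simp [dualDeg]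
  | basept =>
    intro h
    rw [word_basept, hL.basept] at h
    rw [wdeg_inr, ← hα _ (right_ne_zero_of_mul h)]
    rfl
  | basept_inv =>
    intro h
    rw [word_basept_inv, linearization_basept_inv, neg_ne_zero] at h
    rw [wdeg_inr, ← hα _ (left_ne_zero_of_mul h)]
    rfl

theorem quadraticPart_wdeg {p q : ℤ} {β : Hom ρ₂ ρ₃} {α : Hom ρ₁ ρ₂} (hβ : β ∈ HomDeg q ρ₂ ρ₃)
    (hα : α ∈ HomDeg p ρ₁ ρ₂) (w : Word m) :
    quadraticPart β α (word F w) ≠ 0 → wdeg D w = p + q - 2 := by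
  have hQ := isQuadraticPart_quadraticPart β α
  induction w using Word.induction with
  | one => simp [quadraticPart_one]
  | mul v w hv hw =>
    intro h
    rw [map_mul, hQ.deriv.mul] at h
    rw [wdeg_mul]
    by_cases h1 : ρ₁.toAlgHom (word F v) * quadraticPart β α (word F w) = 0
    · rw [h1, zero_add] at h
      by_cases h2 : linearization α (word F v) * linearization β (word F w) = 0
      · rw [h2, zero_add] at h
        rw [hv (left_ne_zero_of_mul h), ρ₃.wdeg_eq_zero (right_ne_zero_of_mul h), add_zero]
      · rw [linearization_wdeg hα v (left_ne_zero_of_mul h2),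
          linearization_wdeg hβ w (right_ne_zero_of_mul h2)]
        ring
    · rw [hw (right_ne_zero_of_mul h1), ρ₁.wdeg_eq_zero (left_ne_zero_of_mul h1), zero_add]
  | chord l => simp [word_chord, hQ.chord]
  | basept => simp [word_basept, hQ.basept]
  | basept_inv =>
    intro h
    rw [word_basept_inv, quadraticPart_basept_inv] at h
    rw [wdeg_inr, ← hα _ (left_ne_zero_of_mul h),
      ← hβ _ (left_ne_zero_of_mul (right_ne_zero_of_mul h))]
    rfl

theorem Rep.deg_eq_zero (ρ : Rep D n) {l : Fin m} (h : ρ.toAlgHom (chord l) ≠ 0) :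
    D.deg l = 0 := by
  rw [← word_chord] at h
  rw [← wdeg_chord (D := D), ρ.wdeg_eq_zero h]

theorem m₁_mem_homDeg {p : ℤ} {α : Hom ρ₁ ρ₂} (hα : α ∈ HomDeg p ρ₁ ρ₂) :
    m₁ α ∈ HomDeg (p + 1) ρ₁ ρ₂ := by
  have hy : α .y ≠ 0 → p = 0 := fun h => (hα _ h).symm
  intro c hc
  cases c with
  | y => exact absurd (m₁_y α) hc
  | x =>
    have h : α .y ≠ 0 := by
      rintro h
      simp [m₁_x, h] at hc
    simp [dualDeg, hy h]
  | a l =>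
    simp only [dualDeg]
    rw [m₁_a] at hc
    by_cases h1 : linearization α (D.d (chord l)) = 0
    · have h : α .y ≠ 0 := by
        rintro h
        simp [h1, h] at hc
      by_cases h2 : ρ₂.toAlgHom (chord l) = 0
      · by_cases h3 : ρ₁.toAlgHom (chord l) = 0
        · simp [h1, h2, h3] at hc
        · rw [ρ₁.deg_eq_zero h3, hy h]
      · rw [ρ₂.deg_eq_zero h2, hy h]
    · have := eq_zero_of_wdeg (linearization_wdeg hα) (D.d_chord_mem_homogeneous l) h1
      linarith

theorem unsignedComp_mem_homDeg {p q : ℤ} {β : Hom ρ₂ ρ₃} {α : Hom ρ₁ ρ₂}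
    (hβ : β ∈ HomDeg q ρ₂ ρ₃) (hα : α ∈ HomDeg p ρ₁ ρ₂) :
    unsignedComp β α ∈ HomDeg (p + q) ρ₁ ρ₃ := by
  intro c hc
  have key : ∀ c₁ c₂, α c₁ * β c₂ ≠ 0 → dualDeg D c₁ + dualDeg D c₂ = p + q := fun c₁ c₂ h => by
    rw [hα _ (left_ne_zero_of_mul h), hβ _ (right_ne_zero_of_mul h)]
  cases c with
  | y => exact key .y .y hc
  | x =>
    by_cases h : α .x * β .y = 0
    · rw [unsignedComp, h, sub_zero] at hc
      have h1 := hα _ (right_ne_zero_of_mul (left_ne_zero_of_mul (left_ne_zero_of_mul hc)))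
      rw [← h1, ← hβ _ (right_ne_zero_of_mul hc)]
      simp [dualDeg]
    · rw [← key .x .y h]
      simp [dualDeg]
  | a l =>
    by_cases h1 : quadraticPart β α (D.d (chord l)) = 0
    · by_cases h2 : α .y * β (.a l) = 0
      · by_cases h3 : α (.a l) * β .y = 0
        · simp [unsignedComp, h1, h2, h3] at hc
        · rw [← key _ _ h3]
          simp [dualDeg]
      · rw [← key _ _ h2]
        simp [dualDeg]
    · have := eq_zero_of_wdeg (quadraticPart_wdeg hβ hα) (D.d_chord_mem_homogeneous l) h1
      simp only [dualDeg]
      linarith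

end Degrees

/-! ### The Leibniz rule. -/

section Leibniz

variable {F : Type*} [Field F] {m : ℕ} {D : KnotDGA F m} {n : ℕ} {ρ₁ ρ₂ ρ₃ : Rep D n}

theorem Rep.negOnePow_smul_chord (ρ : Rep D n) (l : Fin m) :
    Int.negOnePow (D.deg l) • ρ.toAlgHom (chord l) = ρ.toAlgHom (chord l) := by
  rw [← word_chord, ← wdeg_chord (D := D), ρ.negOnePow_smul]

theorem m₁_a' (α : Hom ρ₁ ρ₂) (l : Fin m) : m₁ α (.a l) =
    linearization α (D.d (chord l)) + α .y * ρ₂.toAlgHom (chord l) -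
      ρ₁.toAlgHom (chord l) * α .y := by
  rw [m₁_a, ← smul_mul_assoc, ρ₁.negOnePow_smul_chord]

theorem m₁_neg (α : Hom ρ₁ ρ₂) : m₁ (ρ₁ := ρ₁) (ρ₂ := ρ₂) (-α) = -m₁ α := by
  have h u : linearization (ρ₁ := ρ₁) (ρ₂ := ρ₂) (-α) u = -linearization α u := by
    have h := LinearMap.congr_fun (linearization_smul (ρ₁ := ρ₁) (ρ₂ := ρ₂) (-1) α) u
    rwa [neg_one_smul, LinearMap.smul_apply, neg_one_smul] at h
  funext c
  rw [Pi.neg_apply]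
  cases c with
  | y => simp [m₁_y]
  | x => simp only [m₁_x, Pi.neg_apply]; noncomm_ring
  | a l => simp only [m₁_a', h, Pi.neg_apply]; noncomm_ring

/-- The right side is a derivation: `ρ ∘ ∂ = 0` and the supports of the representations make
`linearization α ∘ ∂` one, and the other two terms form an inner derivation. Agreement on generators
is the formula for `m₁`. -/
theorem linearization_m₁ (α : Hom ρ₁ ρ₂) (u : KnotAlg F m) :
    linearization (m₁ α) u =
      linearization α (D.d u) + α .y * ρ₂.toAlgHom u - ρ₁.toAlgHom u * α .y := by
  have hL := isLinearization_linearization α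
  have h : IsLinearization (m₁ α) (linearization α ∘ₗ D.d +
      LinearMap.mulLeft F (α .y) ∘ₗ ρ₂.toAlgHom.toLinearMap -
      LinearMap.mulRight F (α .y) ∘ₗ ρ₁.toAlgHom.toLinearMap) := by
    refine ⟨fun v w => ?_, fun l => ?_, ?_⟩
    · simp only [LinearMap.sub_apply, LinearMap.add_apply, LinearMap.comp_apply, D.d_word_mul,
        map_add, Units.smul_def, map_zsmul, hL.deriv.mul_of_zero, ρ₁.map_d, ρ₂.map_d,
        LinearMap.mulLeft_apply, LinearMap.mulRight_apply, AlgHom.toLinearMap_apply, Pi.zero_apply]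
      have hs := ρ₁.negOnePow_smul v
      rw [Units.smul_def] at hs
      rw [mul_zero, add_zero, zero_mul, zero_add, ← smul_mul_assoc, hs, map_mul, map_mul, map_mul]
      noncomm_ring
    · simp [m₁_a']
    · simp only [LinearMap.sub_apply, LinearMap.add_apply, LinearMap.comp_apply, D.d_basept,
        map_zero, LinearMap.mulLeft_apply, LinearMap.mulRight_apply, AlgHom.toLinearMap_apply,
        zero_add, m₁_x, mul_sub, ← mul_assoc]
      rw [← map_mul, Units.mul_inv, map_one, one_mul]
  rw [(isLinearization_linearization _).ext h]
  simp

theorem HomDeg.x_eq_zero {α : Hom ρ₁ ρ₂} (hα : α ∈ HomDeg 0 ρ₁ ρ₂) : α .x = 0 := by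
  by_contra h
  exact absurd (hα _ h) one_ne_zero

theorem HomDeg.negOnePow_smul_word {α : Hom ρ₁ ρ₂} (hα : α ∈ HomDeg 0 ρ₁ ρ₂) (w : Word m) :
    Int.negOnePow (wdeg D w) • linearization α (word F w) = -linearization α (word F w) := by
  by_cases h : linearization α (word F w) = 0
  · rw [h, smul_zero, neg_zero]
  · rw [linearization_wdeg hα w h]
    simp

theorem HomDeg.negOnePow_smul {α : Hom ρ₁ ρ₂} (hα : α ∈ HomDeg 0 ρ₁ ρ₂) (l : Fin m) :
    Int.negOnePow (D.deg l) • α (.a l) = -α (.a l) := by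
  have h := HomDeg.negOnePow_smul_word hα (Monoid.Coprod.inl (FreeMonoid.of l))
  rwa [word_chord, (isLinearization_linearization α).chord, wdeg_chord] at h

/-- The right side is again a derivation. The product-rule defect of `quadraticPart β α ∘ ∂` is
`L_α(∂v) L_β(w) - L_α(v) L_β(∂w)`, writing `L` for linearizations; by `linearization_m₁`, the
corrections in the last two terms cancel it together with the defects of the two `y` terms. -/
theorem linearization_unsignedComp {β : Hom ρ₂ ρ₃} {α : Hom ρ₁ ρ₂} (hβ : β ∈ HomDeg 0 ρ₂ ρ₃)
    (hα : α ∈ HomDeg 0 ρ₁ ρ₂) (u : KnotAlg F m) :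
    linearization (unsignedComp β α) u = quadraticPart β α (D.d u) +
      α .y * linearization β u + linearization α u * β .y -
      quadraticPart β (m₁ α) u + quadraticPart (m₁ β) α u := by
  have hLα := isLinearization_linearization α
  have hLβ := isLinearization_linearization β
  have hQ := isQuadraticPart_quadraticPart β α
  have hQ₁ := isQuadraticPart_quadraticPart β (m₁ α)
  have hQ₂ := isQuadraticPart_quadraticPart (m₁ β) α
  have h : IsLinearization (unsignedComp β α) (quadraticPart β α ∘ₗ D.d +
      LinearMap.mulLeft F (α .y) ∘ₗ linearization β +
      LinearMap.mulRight F (β .y) ∘ₗ linearization α - quadraticPart β (m₁ α) +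
      quadraticPart (m₁ β) α) := by
    refine ⟨fun v w => ?_, fun l => ?_, ?_⟩
    · simp only [LinearMap.sub_apply, LinearMap.add_apply, LinearMap.comp_apply, D.d_word_mul,
        map_add, Units.smul_def, map_zsmul, hQ.deriv.mul, hLα.deriv v w, hLβ.deriv v w,
        hQ₁.deriv v w, hQ₂.deriv v w, ρ₁.map_d, ρ₃.map_d, linearization_m₁,
        LinearMap.mulLeft_apply, LinearMap.mulRight_apply, Pi.zero_apply, smul_add]
      have hs := ρ₁.negOnePow_smul v
      have hs' := HomDeg.negOnePow_smul_word hα v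
      rw [Units.smul_def] at hs hs'
      rw [← smul_mul_assoc, ← smul_mul_assoc, hs, hs']
      noncomm_ring
      simp only [zero_add]
    · have hs := HomDeg.negOnePow_smul hα l
      simp only [LinearMap.sub_apply, LinearMap.add_apply, LinearMap.comp_apply, hQ₁.chord,
        hQ₂.chord, hLα.chord, hLβ.chord, LinearMap.mulLeft_apply, LinearMap.mulRight_apply,
        unsignedComp, ← smul_mul_assoc, hs]
      noncomm_ring
    · simp [D.d_basept, hQ₁.basept, hQ₂.basept, hLα.basept, hLβ.basept, unsignedComp,
        HomDeg.x_eq_zero hα, HomDeg.x_eq_zero hβ]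
  rw [(isLinearization_linearization _).ext h]
  simp

/-- The Leibniz rule for `m₁` and `m₂` in degree `0`. -/
theorem m₁_unsignedComp {β : Hom ρ₂ ρ₃} {α : Hom ρ₁ ρ₂} (hβ : β ∈ HomDeg 0 ρ₂ ρ₃)
    (hα : α ∈ HomDeg 0 ρ₁ ρ₂) :
    m₁ (unsignedComp β α) = unsignedComp (m₁ β) α - unsignedComp β (m₁ α) := by
  funext c
  rw [Pi.sub_apply]
  cases c with
  | y => simp [m₁_y, unsignedComp]
  | x =>
    have ht : ρ₂.toAlgHom (basept F m) * ρ₂.toAlgHom ((basept F m)⁻¹ : (KnotAlg F m)ˣ) = 1 := by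
      rw [← map_mul, Units.mul_inv, map_one]
    have h : ∀ a b c d : Mat n F, a * b * ρ₂.toAlgHom (basept F m) *
        (ρ₂.toAlgHom ((basept F m)⁻¹ : (KnotAlg F m)ˣ) * c * d) = a * (b * c) * d := by
      intro a b c d
      calc _ = a * b * (ρ₂.toAlgHom (basept F m) *
          ρ₂.toAlgHom ((basept F m)⁻¹ : (KnotAlg F m)ˣ)) * c * d := by noncomm_ring
        _ = _ := by rw [ht]; noncomm_ring
    simp only [m₁_x, m₁_y, unsignedComp, HomDeg.x_eq_zero hα, HomDeg.x_eq_zero hβ, mul_sub, h]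
    noncomm_ring
  | a l =>
    -- Since `m₁ α` has degree 1, its `a_l` coefficient is nonzero only when `|a_l| = 0`, where the
    -- sign is trivial.
    have hd : Int.negOnePow (D.deg l) • (m₁ α (.a l) * β .y) =
        m₁ α (.a l) * β .y := by
      by_cases h : m₁ α (.a l) = 0
      · rw [h, zero_mul, smul_zero]
      · have h1 := m₁_mem_homDeg hα _ h
        simp only [dualDeg, zero_add, add_eq_right] at h1
        rw [h1, Int.negOnePow_zero, one_smul]
    -- At `u = ∂ a_l` the term `quadraticPart β α (∂ u)` vanishes by `∂² = 0`, and what remains is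
    -- the `a_l` component of the Leibniz rule.
    have hW := linearization_unsignedComp hβ hα (D.d (chord l))
    rw [D.d_d, map_zero, zero_add] at hW
    simp only [unsignedComp, hd, m₁_y, mul_zero, zero_mul, smul_zero]
    rw [m₁_a', hW]
    simp only [m₁_a', unsignedComp]
    noncomm_ring

end Leibniz

/-! ### Triangularity of composition and invertible cocycles. -/

section Triangularity

variable {F : Type*} [Field F] {m : ℕ} {D : KnotDGA F m} {n : ℕ} {ρ₁ ρ₂ ρ₃ : Rep D n}

/-- The linear and quadratic terms of `∂ a_l` only involve chords of smaller height. -/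
theorem quadraticPart_d_chord_eq_zero {β : Hom ρ₂ ρ₃} {α : Hom ρ₁ ρ₂} (l : Fin m)
    (h : (α .x = 0 ∧ ∀ j, D.height j < D.height l → α (.a j) = 0) ∨
      (β .x = 0 ∧ ∀ j, D.height j < D.height l → β (.a j) = 0)) :
    quadraticPart β α (D.d (chord l)) = 0 := by
  have hQ := isQuadraticPart_quadraticPart β α
  -- A derivation vanishing on `t` and the lower chords vanishes on the subalgebra they generate.
  -- One factor of the correction term is then zero there, so the quadratic part dies by induction
  -- too.
  have hL : ∀ {ρ₁ ρ₂ : Rep D n} {α : Hom ρ₁ ρ₂},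
      (α .x = 0 ∧ ∀ j, D.height j < D.height l → α (.a j) = 0) →
      ∀ u ∈ Algebra.adjoin F
        ({x : KnotAlg F m | ∃ j : Fin m, D.height j < D.height l ∧ x = chord j} ∪
        {x : KnotAlg F m | x = basept F m ∨ x = ((basept F m)⁻¹ : (KnotAlg F m)ˣ)}),
      linearization α u = 0 := by
    intro ρ₁ ρ₂ α ⟨hx, ha⟩ u hu
    have hL := isLinearization_linearization α
    induction hu using Algebra.adjoin_induction with
    | mem u hu =>
      obtain ⟨j, hj, rfl⟩ | rfl | rfl := hu
      · rw [hL.chord, ha j hj]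
      · rw [hL.basept, hx, mul_zero]
      · rw [linearization_basept_inv, hx, zero_mul, neg_zero]
    | algebraMap r => rw [Algebra.algebraMap_eq_smul_one, map_smul, hL.deriv.map_one, smul_zero]
    | add u v _ _ hu hv => rw [map_add, hu, hv, add_zero]
    | mul u v _ _ hu hv => rw [hL.deriv.mul_of_zero, hu, hv, mul_zero, zero_mul, add_zero]
  refine Algebra.adjoin_induction (p := fun u _ => quadraticPart β α u = 0) ?_ ?_ ?_ ?_
    (D.d_chord_mem l)
  · rintro u (⟨j, hj, rfl⟩ | rfl | rfl)
    · exact hQ.chord j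
    · exact hQ.basept
    · rw [quadraticPart_basept_inv]
      rcases h with h | h <;> simp [h.1]
  · intro r
    rw [Algebra.algebraMap_eq_smul_one, map_smul, quadraticPart_one, smul_zero]
  · intro u v _ _ hu hv
    rw [map_add, hu, hv, add_zero]
  · intro u v hu' hv' hu hv
    rw [hQ.deriv.mul, hu, hv]
    rcases h with h | h
    · simp [hL h u hu']
    · simp [hL h v hv']

/-- Induction on height; it is well founded because there are finitely many chords, even if some
heights coincide. -/
theorem eq_zero_of_height (D : KnotDGA F m) {α : HomGen m → Mat n F} (hy : α .y = 0)
    (hx : α .x = 0)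
    (ha : ∀ l, (∀ j, D.height j < D.height l → α (.a j) = 0) → α (.a l) = 0) : α = 0 := by
  have h : ∀ l, α (.a l) = 0 := by
    intro l
    have hwf : WellFounded fun i j : Fin m => D.height i < D.height j :=
      haveI : IsTrans (Fin m) fun i j => D.height i < D.height j := ⟨fun _ _ _ => lt_trans⟩
      haveI : Std.Irrefl fun i j : Fin m => D.height i < D.height j := ⟨fun _ => lt_irrefl _⟩
      Finite.wellFounded_of_trans_of_irrefl _
    induction l using hwf.induction with
    | _ l ih => exact ha l ih
  funext c
  cases c with
  | y => exact hy
  | x => exact hx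
  | a l => exact h l

/-- Composition on the left with an element with invertible coefficient of `y^∨` is
injective. -/
theorem eq_zero_of_unsignedComp_left {g : Hom ρ₂ ρ₃}
    (hu : IsUnit (g .y)) {α : Hom ρ₁ ρ₂} (h : unsignedComp g α = 0) : α = 0 := by
  have hy : α .y = 0 := hu.mul_left_eq_zero.1 (congrFun h .y)
  have hx : α .x = 0 := by
    have h1 := congrFun h .x
    simp only [unsignedComp, hy, mul_zero, zero_mul, zero_sub, Pi.zero_apply, neg_eq_zero] at h1
    exact hu.mul_left_eq_zero.1 h1
  -- With the `y`, `x` and lower chord coefficients gone, the `a_l` component is `±α(a_l) g_y`.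
  refine eq_zero_of_height D hy hx fun l hl => ?_
  have h1 := congrFun h (.a l)
  simp only [unsignedComp, hy, quadraticPart_d_chord_eq_zero l (Or.inl ⟨hx, hl⟩), zero_mul,
    zero_add, zero_sub, Pi.zero_apply, neg_eq_zero, smul_eq_zero_iff_eq] at h1
  exact hu.mul_left_eq_zero.1 h1

/-- Composition on the right with an element with invertible coefficient of `y^∨` is
injective. -/
theorem eq_zero_of_unsignedComp_right {g : Hom ρ₁ ρ₂}
    (hu : IsUnit (g .y)) {β : Hom ρ₂ ρ₃} (h : unsignedComp β g = 0) : β = 0 := by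
  have hy : β .y = 0 := hu.mul_right_eq_zero.1 (congrFun h .y)
  have hx : β .x = 0 := by
    have h1 := congrFun h .x
    simp only [unsignedComp, hy, mul_zero, sub_zero, Pi.zero_apply] at h1
    have hu' : IsUnit (ρ₁.toAlgHom ((basept F m)⁻¹ : (KnotAlg F m)ˣ) * g .y *
        ρ₂.toAlgHom (basept F m)) :=
      ((Units.isUnit _).map ρ₁.toAlgHom).mul hu |>.mul ((Units.isUnit _).map ρ₂.toAlgHom)
    exact hu'.mul_right_eq_zero.1 h1
  refine eq_zero_of_height D hy hx fun l hl => ?_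
  have h1 := congrFun h (.a l)
  simp only [unsignedComp, hy, quadraticPart_d_chord_eq_zero l (Or.inr ⟨hx, hl⟩), mul_zero,
    zero_add, smul_zero, sub_zero, Pi.zero_apply] at h1
  exact hu.mul_right_eq_zero.1 h1

/-- The elements of degree `0`, as a subspace. -/
def degZero (D : KnotDGA F m) (n : ℕ) : Submodule F (HomGen m → Mat n F) where
  carrier := {α | ∀ c, α c ≠ 0 → dualDeg D c = 0}
  add_mem' {α β} hα hβ c hc := by
    by_cases h : α c = 0
    · exact hβ c fun h' => hc (by simp [h, h'])
    · exact hα c h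
  zero_mem' c hc := absurd rfl hc
  smul_mem' r α hα c hc := hα c fun h => hc (by simp [h])

/-- An injective endomorphism of the finite-dimensional degree-0 space is surjective. All the spaces
`Hom` share the same underlying vector space, so composition can be treated as an endomorphism. -/
theorem exists_of_injective {f : (HomGen m → Mat n F) →ₗ[F] HomGen m → Mat n F}
    (hf : ∀ α, f α = 0 → α = 0) (hd : ∀ α ∈ degZero D n, f α ∈ degZero D n)
    {γ : HomGen m → Mat n F} (hγ : γ ∈ degZero D n) : ∃ α ∈ degZero D n, f α = γ := by
  have hinj : Function.Injective (f.restrict hd) := by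
    rw [injective_iff_map_eq_zero]
    intro α hα
    exact Subtype.ext (hf α (congrArg Subtype.val hα))
  obtain ⟨α, hα⟩ := LinearMap.surjective_of_injective hinj ⟨γ, hγ⟩
  exact ⟨α, α.2, congrArg Subtype.val hα⟩

theorem m₂_eq_neg {β : Hom ρ₂ ρ₃} {α : Hom ρ₁ ρ₂} (hβ : β ∈ HomDeg 0 ρ₂ ρ₃)
    (hα : α ∈ HomDeg 0 ρ₁ ρ₂) : m₂ β α = -unsignedComp β α := by
  rw [m₂_eq hβ hα]
  simp

theorem exists_m₂_left {g : Hom ρ₂ ρ₃} (hg : g ∈ HomDeg 0 ρ₂ ρ₃) (hu : IsUnit (g .y))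
    {γ : Hom ρ₁ ρ₃} (hγ : γ ∈ HomDeg 0 ρ₁ ρ₃) : ∃ α ∈ HomDeg 0 ρ₁ ρ₂, m₂ g α = γ := by
  obtain ⟨α, hα, h⟩ := exists_of_injective (D := D) (f := unsignedCompHom ρ₁ ρ₂ ρ₃ g)
    (fun α h => eq_zero_of_unsignedComp_left hu (ρ₁ := ρ₁) h)
    (fun α hα => unsignedComp_mem_homDeg (p := 0) (q := 0) hg (ρ₁ := ρ₁) hα)
    ((degZero D n).neg_mem hγ)
  refine ⟨α, hα, ?_⟩
  rw [m₂_eq_neg hg hα]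
  exact neg_eq_iff_eq_neg.2 h

theorem exists_m₂_right {g : Hom ρ₁ ρ₂} (hg : g ∈ HomDeg 0 ρ₁ ρ₂) (hu : IsUnit (g .y))
    {γ : Hom ρ₁ ρ₃} (hγ : γ ∈ HomDeg 0 ρ₁ ρ₃) : ∃ β ∈ HomDeg 0 ρ₂ ρ₃, m₂ β g = γ := by
  obtain ⟨β, hβ, h⟩ := exists_of_injective (D := D) (f := (unsignedCompHom ρ₁ ρ₂ ρ₃).flip g)
    (fun β h => eq_zero_of_unsignedComp_right hu (ρ₃ := ρ₃) h)
    (fun β hβ => unsignedComp_mem_homDeg (p := 0) (q := 0) (ρ₃ := ρ₃) hβ hg)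
    ((degZero D n).neg_mem hγ)
  refine ⟨β, hβ, ?_⟩
  rw [m₂_eq_neg hβ hg]
  exact neg_eq_iff_eq_neg.2 h

theorem unitHom_mem (ρ : Rep D n) : unitHom ρ ∈ HomDeg 0 ρ ρ := by
  intro c hc
  cases c with
  | y => rfl
  | x => exact absurd rfl hc
  | a l => exact absurd rfl hc

theorem mul_y_eq_one {ρ₁ ρ₂ : Rep D n} {β : Hom ρ₂ ρ₁} {α : Hom ρ₁ ρ₂} (hβ : β ∈ HomDeg 0 ρ₂ ρ₁)
    (hα : α ∈ HomDeg 0 ρ₁ ρ₂) (h : m₂ β α .y = -1) : α .y * β .y = 1 := by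
  rw [m₂_eq_neg hβ hα] at h
  exact neg_injective h

/-- The invertible cocycles are those with invertible coefficient of `y^∨`. -/
theorem mem_invertibleCocycles {α : Hom ρ₁ ρ₂} : α ∈ InvertibleCocycles ρ₁ ρ₂ ↔
    α ∈ HomDeg 0 ρ₁ ρ₂ ∧ m₁ α = 0 ∧ IsUnit (α .y) := by
  constructor
  · rintro ⟨h0, h1, ⟨β, hβ, h⟩, -⟩
    -- For square matrices over a field a one-sided inverse suffices.
    exact ⟨h0, h1, IsUnit.of_mul_eq_one _ (mul_y_eq_one hβ h0 (congrFun h .y))⟩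
  · rintro ⟨h0, h1, hu⟩
    exact ⟨h0, h1, exists_m₂_right h0 hu (unitHom_mem _), exists_m₂_left h0 hu (unitHom_mem _)⟩

/-- Invertibility at `y^∨` passes both ways because those coefficients multiply. Closedness passes
both ways because `m₁ (m₂ g α)` is `unsignedComp g (m₁ α)` and composition with `g` is injective. -/
theorem bijOn_m₂ {g : Hom ρ₂ ρ₃} (hg : g ∈ InvertibleCocycles ρ₂ ρ₃) :
    Set.BijOn (fun α : Hom ρ₁ ρ₂ => (m₂ g α : Hom ρ₁ ρ₃))
      (InvertibleCocycles ρ₁ ρ₂) (InvertibleCocycles ρ₁ ρ₃) := by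
  obtain ⟨hg0, hg1, hu⟩ := mem_invertibleCocycles.1 hg
  have hm₁ : ∀ {α : Hom ρ₁ ρ₂}, α ∈ HomDeg 0 ρ₁ ρ₂ →
      m₁ (m₂ g α) = unsignedComp g (m₁ α) := by
    intro α hα
    have h : unsignedComp (0 : Hom ρ₂ ρ₃) α = 0 := LinearMap.map_zero₂ (unsignedCompHom ρ₁ ρ₂ ρ₃) α
    rw [m₂_eq_neg hg0 hα, m₁_neg, m₁_unsignedComp hg0 hα, hg1, h, zero_sub, neg_neg]
  refine ⟨fun α hα => ?_, fun α hα α' hα' h => ?_, fun γ hγ => ?_⟩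
  · obtain ⟨h0, h1, h2⟩ := mem_invertibleCocycles.1 hα
    change m₂ g α ∈ _
    refine mem_invertibleCocycles.2 ⟨?_, ?_, ?_⟩
    · rw [m₂_eq_neg hg0 h0]
      exact (degZero D n).neg_mem (unsignedComp_mem_homDeg (p := 0) (q := 0) hg0 h0)
    · rw [hm₁ h0, h1]
      exact map_zero (unsignedCompHom ρ₁ ρ₂ ρ₃ g)
    · rw [m₂_eq_neg hg0 h0]
      exact (h2.mul hu).neg
  · have h0 := (mem_invertibleCocycles.1 hα).1
    have h0' := (mem_invertibleCocycles.1 hα').1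
    simp only [m₂_eq_neg hg0 h0, m₂_eq_neg hg0 h0', neg_inj] at h
    refine sub_eq_zero.1 (eq_zero_of_unsignedComp_left (ρ₁ := ρ₁) hu ?_)
    exact (map_sub (unsignedCompHom ρ₁ ρ₂ ρ₃ g) α α').trans (sub_eq_zero.2 h)
  · obtain ⟨h0, h1, h2⟩ := mem_invertibleCocycles.1 hγ
    obtain ⟨α, hα, rfl⟩ := exists_m₂_left hg0 hu h0
    refine ⟨α, mem_invertibleCocycles.2 ⟨hα, ?_, ?_⟩, rfl⟩
    · rw [hm₁ hα] at h1
      -- Injectivity holds in every degree and is applied here to `m₁ α`, of degree 1.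
      exact eq_zero_of_unsignedComp_left hu h1
    · rw [m₂_eq_neg hg0 hα] at h2
      have h3 : IsUnit (α .y * g .y) := by simpa [unsignedComp] using h2
      exact (IsUnit.mul_right_iff hu).1 h3

end Triangularity

end LegRep

theorem mainTheorem5 {F : Type*} [Field F] {m : ℕ} (D : LegRep.KnotDGA F m) (n : ℕ)
    (ρ ρ₀ : LegRep.Rep D n) (h : LegRep.Isomorphic ρ ρ₀) :
    Nonempty (LegRep.InvertibleCocycles ρ ρ₀ ≃ LegRep.InvertibleCocycles ρ ρ) ∧
    (LegRep.InvertibleCocycles ρ₀ ρ).Nonempty ∧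
    ∀ g ∈ LegRep.InvertibleCocycles ρ₀ ρ,
      Set.BijOn (fun α : LegRep.Hom ρ ρ₀ => (LegRep.m₂ g α : LegRep.Hom ρ ρ))
        (LegRep.InvertibleCocycles ρ ρ₀) (LegRep.InvertibleCocycles ρ ρ) := by
  obtain ⟨α, hα, β, hβ, -, hβ1, ⟨γ, -, hγ⟩, -⟩ := h
  -- The homotopy term `m₁ γ` has no `y^∨` coefficient, so the relation up to coboundary is exact
  -- there.
  have hu : α .y * β .y = 1 := LegRep.mul_y_eq_one hβ hα (by
    rw [hγ, Pi.add_apply, LegRep.m₁_y, add_zero]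
    rfl)
  have hg : β ∈ LegRep.InvertibleCocycles ρ₀ ρ :=
    LegRep.mem_invertibleCocycles.2 ⟨hβ, hβ1, IsUnit.of_mul_eq_one_right _ hu⟩
  exact ⟨⟨(LegRep.bijOn_m₂ hg).equiv _⟩, ⟨β, hg⟩, fun g hg => LegRep.bijOn_m₂ hg⟩
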